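/- Let $n,m\ge 0$ and $h\ge 1$ be integers and consider a system $\partial_t^h u^i=F^i$, $i=1,\dots,m$, in the independent variables $t,x_1,\dots,x_n$. Write $u^i_{s,I}=\partial_t^s\partial_x^I u^i$ for $0\le s<h$ and multi-indices $I\in\mathbb Z_{\ge0}^n$. Let $U$ be an open set in the space of the coordinates $t,x_j,u^i_{s,I}$ (product topology). All functions below are smooth functions on $U$ of finitely many of these coordinates. The $F^i$ depend only on $t$, $x_j$, the $u^b_{0,I}$ and the $u^a_{s,0}$, $s<h$. Let $D_{x_j}$ be the total derivatives, $D_x^I=D_{x_1}^{i_1}\cdots D_{x_n}^{i_n}$, and let $$D_t=\frac{\partial}{\partial t}+\sum_{k,I,\,s<h-1}u^k_{s+1,I}\frac{\partial}{\partial u^k_{s,I}}+\sum_{k,I}D_x^I(F^k)\frac{\partial}{\partial u^k_{h-1,I}}.$$ The order $\mathrm o(f)$ of a vector function $f$ is the maximal $|I|$ such that $\partial f/\partial u^i_{s,I}\not\equiv0$ on $U$ for some $s,i$, and $-1$ if there is none; $\mathrm t(f)$ is the maximal $s$ such that $\partial f/\partial u^i_{s,I}\not\equiv 0$ for some $i$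 and some $I$ with $|I|=\mathrm o(f)$. The symbol of $f$ is the matrix $\mathbf S_f$ with entries $\sum_{|I|=\mathrm o(f)}\frac{\partial f_i}{\partial u^j_{\mathrm t(f),I}}\,q^I$, which are polynomials in $q_1,\dots,q_n$ whose coefficients are functions on $U$. Put $F=(F^1,\dots,F^m)$, $N=\mathrm o(F)$, assume $N>0$, and let $A=\mathbf S_F$. Let $$[L]_{ij}=\sum_{I}(-1)^{|I|}D_x^I\circ\frac{\partial F^j}{\partial u^i_{0,I}}+\sum_{0<s<h}(-1)^sD_t^s\circ\frac{\partial F^j}{\partial u^i_{s,0}},$$ write $[L]_{ij}=\sum_K f^{ij}_KD_x^K+\sum_{0<r<h}g^{ij}_rD_t^r$ by the Leibniz rule, and set $O=\max_{i,j,K,r}\{-1,\ \mathrm o(f^{ij}_K)-N,\ \mathrm o(g^{ij}_r)-N\}$. A conserved current is a tuple $(J_0,J_1,\dots,J_n)$ with $D_tJ_0+\sum_jD_{x_j}J_j=0$ on $U$. The characteristic of the conservation law it represents is $\chi=(\chi_1,\dots,\chi_m)$, $\chi_i=\sum_I(-1)^{|I|}D_x^I\bigl(\partial J_0/\partial u^i_{h-1,I}\bigr)$,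 and the order of the conservation law is $\mathrm o(\chi)$. The symbols are regarded over a field as follows. Let $B$ be an $\mathbb R$-algebra of functions on $U$ that contains the coefficients of all entries of $A$ and $\mathbf S_\chi$, and let $\varphi:B\to k$ be a ring homomorphism to a field (for example, the evaluation at a point of $U$, with $k=\mathbb R$; or, if $B$ is an integral domain, the inclusion into its field of fractions). Applying $\varphi$ to the coefficients gives matrices $A^\varphi,\mathbf S_\chi^\varphi$ over the field $k(q_1,\dots,q_n)$. The invariant factors of an $m\times m$ matrix $M$ over a field $K$ are the monic polynomials $d_1\mid d_2\mid\dots\mid d_m$ in $K[\lambda]$ such that $M-\lambda\mathbf I=C_1\,\mathrm{diag}(d_1,\dots,d_m)\,C_2$ with $C_1,C_2$ invertible over $K[\lambda]$. A polynomial $d$ is skew if $d(-\lambda)=(-1)^{\deg d}d(\lambda)$. **Theorem.** Suppose that $N+h$ is odd and that the system has a conservation law of order greater than $O$, with characteristic $\chi$, whose symbol is nonsingular over $k(q_1,\dots,q_n)$, i.e. $\det\mathbf S_\chi^\varphi\ne0$. Then all invariant factors of $A^\varphi$ are skew, and its characteristic polynomial is skew. In particular $\mathrm{tr}\,A^\varphi=0$,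 and $\det A^\varphi=0$ if $m$ is odd. -/

import Mathlib

open scoped ContDiff

noncomputable section

namespace GenEvol

/-- Coordinates `t`, `x_j` and `u^i_{s,I}` (with `s < h`, `I` a multi-index in `n` variables)
on the infinite prolongation of a system `∂_t^h u^i = F^i`, `i = 1, …, m`. -/
inductive Coord (n m h : ℕ) : Type
  | t : Coord n m h
  | x (j : Fin n) : Coord n m h
  | u (s : Fin h) (i : Fin m) (I : Fin n →₀ ℕ) : Coord n m h

/-- Points are given by the values of all coordinates; the topology is the product topology. -/
abbrev Jet (n m h : ℕ) : Type := Coord n m h → ℝ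

/-- Functions of the coordinates. Only their values on the domain `U` under consideration matter. -/
abbrev JetFun (n m h : ℕ) : Type := Jet n m h → ℝ

/-- On `U`, the function `f` is a smooth function of finitely many coordinates from `V`. -/
def IsSmoothIn {n m h : ℕ} (V : Set (Coord n m h)) (U : Set (Jet n m h)) (f : JetFun n m h) :
    Prop :=
  ∃ T : Finset (Coord n m h), (T : Set (Coord n m h)) ⊆ V ∧
    ∃ g : (T → ℝ) → ℝ,
      ContDiffOn ℝ ∞ g ((fun (p : Jet n m h) (c : T) => p c) '' U) ∧
        ∀ p ∈ U, f p = g (fun c : T => p c)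

/-- The partial derivative with respect to the coordinate `c`. -/
def pd {n m h : ℕ} (c : Coord n m h) (f : JetFun n m h) : JetFun n m h :=
  open Classical in fun p => deriv (fun r : ℝ => f (Function.update p c r)) (p c)

/-- The total derivative with respect to `x_j`. -/
def Dx {n m h : ℕ} (j : Fin n) (f : JetFun n m h) : JetFun n m h := fun p =>
  pd (Coord.x j) f p +
    ∑ᶠ c : Fin h × Fin m × (Fin n →₀ ℕ),
      p (Coord.u c.1 c.2.1 (c.2.2 + Finsupp.single j 1)) * pd (Coord.u c.1 c.2.1 c.2.2) f p

/-- The iterated total derivative `D_{x_1}^{i_1} ⋯ D_{x_n}^{i_n}`, `I = (i_1, …, i_n)`. -/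
def DxI {n m h : ℕ} (I : Fin n →₀ ℕ) (f : JetFun n m h) : JetFun n m h :=
  (List.finRange n).foldr (fun j g => (Dx j)^[I j] g) f

/-- The total derivative with respect to `t` in virtue of the system `∂_t^h u^i = F^i`: it takes
`u^k_{s,I}` to `u^k_{s+1,I}` if `s < h - 1`, and `u^k_{h-1,I}` to `D_x^I (F^k)`. -/
def Dt {n m h : ℕ} (F : Fin m → JetFun n m h) (f : JetFun n m h) : JetFun n m h := fun p =>
  pd Coord.t f p +
    ∑ᶠ c : Fin h × Fin m × (Fin n →₀ ℕ),
      (if hs : (c.1 : ℕ) + 1 < h then p (Coord.u ⟨(c.1 : ℕ) + 1, hs⟩ c.2.1 c.2.2)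
        else DxI c.2.2 (F c.2.1) p) * pd (Coord.u c.1 c.2.1 c.2.2) f p

/-- The coordinates on which the right-hand sides `F^i` may depend: `t`, `x_j`, the pure space
derivatives `u^i_{0,I}` and the pure time derivatives `u^i_{s,0}`, `s < h`. -/
def admissible (n m h : ℕ) : Set (Coord n m h) :=
  {c | ∀ s i I, c = Coord.u s i I → (s : ℕ) = 0 ∨ I = 0}

/-- `(J₀, J_1, …, J_n)` is a conserved current on `U` of the system `∂_t^h u^i = F^i`. -/
def IsConservedCurrent {n m h : ℕ} (U : Set (Jet n m h)) (F : Fin m → JetFun n m h)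
    (J₀ : JetFun n m h) (J : Fin n → JetFun n m h) : Prop :=
  IsSmoothIn Set.univ U J₀ ∧ (∀ j, IsSmoothIn Set.univ U (J j)) ∧
    ∀ p ∈ U, Dt F J₀ p + ∑ j, Dx j (J j) p = 0

/-- The characteristic of the conservation law represented by a conserved current with
`t`-component `J₀`: `χ_i = ∑_I (-1)^|I| D_x^I (∂J₀ / ∂u^i_{h-1,I})`. -/
def characteristic {n m h : ℕ} [NeZero h] (J₀ : JetFun n m h) (i : Fin m) : JetFun n m h := fun p =>
  ∑ᶠ I : Fin n →₀ ℕ, (-1) ^ I.degree *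
    DxI I (pd (Coord.u ⟨h - 1, Nat.sub_lt (NeZero.pos h) one_pos⟩ i I) J₀) p

/-- The order `o(f)` of a vector function on `U`: the maximal `|I|` such that
`∂f/∂u^i_{s,I}` is not identically zero for some `s`, `i`, and `-1` if there is no such `I`. -/
def order {n m h : ℕ} {ι : Type*} (U : Set (Jet n m h)) (f : ι → JetFun n m h) : ℤ :=
  sSup (insert (-1) {d : ℤ | ∃ s i I, d = (I.degree : ℤ) ∧
    ∃ a, ∃ p ∈ U, pd (Coord.u s i I) (f a) p ≠ 0})

/-- `t(f)`: the maximal `s` such that `∂f/∂u^i_{s,I}` is not identically zero on `U` for some `i`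
and some `I` with `|I| = o(f)` (meaningful if `o(f) ≥ 0`). -/
def timeOrder {n m h : ℕ} [NeZero h] {ι : Type*} (U : Set (Jet n m h)) (f : ι → JetFun n m h) :
    Fin h :=
  open Classical in
  (Finset.univ.filter fun s : Fin h => ∃ i I, (I.degree : ℤ) = order U f ∧
    ∃ a, ∃ p ∈ U, pd (Coord.u s i I) (f a) p ≠ 0).sup id

/-- The matrix `S^{a,b}(f)`, with entries `∑_{|I| = a} (∂f_i/∂u^j_{b,I}) q^I`: polynomials in
`q_1, …, q_n` whose coefficients are functions on `U`. -/
def symbolAt {n m h : ℕ} {ι : Type*} (U : Set (Jet n m h)) (a : ℕ) (b : Fin h)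
    (f : ι → JetFun n m h) : Matrix ι (Fin m) (MvPolynomial (Fin n) (U → ℝ)) := fun i j =>
  ∑ I ∈ (Finset.univ : Finset (Fin n)).finsuppAntidiag a,
    MvPolynomial.monomial I (fun p : U => pd (Coord.u b j I) (f i) p)

/-- The symbol `S^{o(f),t(f)}(f)` of a vector function (meaningful if `o(f) ≥ 0`). -/
def symbol {n m h : ℕ} [NeZero h] {ι : Type*} (U : Set (Jet n m h)) (f : ι → JetFun n m h) :
    Matrix ι (Fin m) (MvPolynomial (Fin n) (U → ℝ)) :=
  symbolAt U (order U f).toNat (timeOrder U f) f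

/-- The adjoint linearized equation reads `(-1)^h D_t^h χ = L χ` with
`[L]_{ij} = ∑_I (-1)^|I| D_x^I ∘ ∂F^j/∂u^i_{0,I} + ∑_{0<s<h} (-1)^s D_t^s ∘ ∂F^j/∂u^i_{s,0}`.
By the Leibniz rule, `[L]_{ij} = ∑_K f_K^{ij} D_x^K + ∑_{0<r<h} g_r^{ij} D_t^r`.
This is the coefficient `f_K^{ij}`. -/
def coeffX {n m h : ℕ} [NeZero h] (F : Fin m → JetFun n m h) (i j : Fin m) (K : Fin n →₀ ℕ) :
    JetFun n m h := fun p =>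
  (∑ᶠ I : Fin n →₀ ℕ, (-1) ^ (K + I).degree * (∏ a, (((K + I) a).choose (K a) : ℝ)) *
      DxI I (pd (Coord.u 0 i (K + I)) (F j)) p) +
    if K = 0 then
      ∑ s : Fin h, if s = 0 then 0 else (-1) ^ (s : ℕ) * (Dt F)^[s] (pd (Coord.u s i 0) (F j)) p
    else 0

/-- The coefficient `g_r^{ij}`, `0 < r < h`, of the operator `L` described at `coeffX`. -/
def coeffT {n m h : ℕ} (F : Fin m → JetFun n m h) (i j : Fin m) (r : Fin h) :
    JetFun n m h := fun p =>
  ∑ s : Fin h, if r ≤ s then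
    (-1) ^ (s : ℕ) * ((s : ℕ).choose (r : ℕ) : ℝ) *
      (Dt F)^[(s : ℕ) - (r : ℕ)] (pd (Coord.u s i 0) (F j)) p
  else 0

/-- The number `O = max {-1, o(f_K^{ij}) - N, o(g_r^{ij}) - N}`, where `N = o(F^1, …, F^m)`. -/
def orderBound {n m h : ℕ} [NeZero h] (U : Set (Jet n m h)) (F : Fin m → JetFun n m h) : ℤ :=
  sSup (insert (-1)
    ({d : ℤ | ∃ i j K, d = order U (fun _ : Unit => coeffX F i j K) - order U F} ∪
      {d : ℤ | ∃ i j r, r ≠ 0 ∧ d = order U (fun _ : Unit => coeffT F i j r) - order U F}))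

/-- `d_1, …, d_k` are the invariant factors of `A`: monic polynomials, each dividing the next, with
`A - λ I = C₁ diag(d_1, …, d_k) C₂` for unimodular polynomial matrices `C₁`, `C₂`. -/
def IsInvariantFactors {K : Type*} [Field K] {k : ℕ} (A : Matrix (Fin k) (Fin k) K)
    (d : Fin k → Polynomial K) : Prop :=
  (∀ i, (d i).Monic) ∧ (∀ i j, i ≤ j → d i ∣ d j) ∧
    ∃ C₁ C₂ : Matrix (Fin k) (Fin k) (Polynomial K), IsUnit C₁.det ∧ IsUnit C₂.det ∧
      A.map Polynomial.C - Matrix.scalar (Fin k) Polynomial.X = C₁ * Matrix.diagonal d * C₂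

/-- A polynomial is skew if `d(-λ) = (-1)^(deg d) d(λ)`. -/
def IsSkew {K : Type*} [Field K] (d : Polynomial K) : Prop :=
  d.comp (-Polynomial.X) = (-1) ^ d.natDegree * d

/-- The matrix over the field `k(q_1, …, q_n)` obtained from a matrix with entries in
`B[q_1, …, q_n]` by applying `φ : B → k` to the coefficients of its entries. -/
def specialize {n m : ℕ} {B k : Type*} [CommRing B] [Field k] (φ : B →+* k)
    (M : Matrix (Fin m) (Fin m) (MvPolynomial (Fin n) B)) :
    Matrix (Fin m) (Fin m) (FractionRing (MvPolynomial (Fin n) k)) :=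
  M.map fun P => algebraMap (MvPolynomial (Fin n) k) (FractionRing (MvPolynomial (Fin n) k))
    (MvPolynomial.map φ P)

end GenEvol

end

open GenEvol

/-! For smooth functions of finitely many coordinates the characteristic `χ` of a conservation law
satisfies the adjoint linearized equation `(-D_t)^h χ = L χ`. Let `M = o(χ)` and `c = t(χ)`. If
`M > O`, then the derivatives of order `M + N` of both sides with respect to the `u^j_{c,I}` come
only from `D_t^h` acting through `F` on the left, and from the terms of `L` of order `N` on the
right. Comparing them gives `(-1)^h S_χ A = (-1)^N Aᵀ S_χ`, that is, `S_χ A = -Aᵀ S_χ` for odd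
`N + h`. Where `S_χ` is invertible, `A` is therefore similar to `-Aᵀ`, which has the same invariant
factors as `-A`. -/

noncomputable section

namespace GenEvol

section LinearAlgebra

open Polynomial Matrix

theorem dvd_of_mul_diagonal_eq_diagonal_mul {ι R : Type*} [Fintype ι] [LinearOrder ι]
    [LocallyFiniteOrderBot ι] [CommRing R] [IsDomain R] [GCDMonoid R] {d e : ι → R}
    (hd : ∀ i j, i ≤ j → d i ∣ d j) (he : ∀ i j, i ≤ j → e i ∣ e j) {P Q : Matrix ι ι R}
    (hP : IsUnit P.det) (h : P * diagonal e = diagonal d * Q) {r : ι} (hr : d r ≠ 0) :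
    d r ∣ e r := by
  obtain ⟨d', e', hd', he', hcoprime⟩ := extract_gcd (d r) (e r)
  have hgcd : gcd (d r) (e r) ≠ 0 := fun h0 => hr ((gcd_eq_zero_iff _ _).1 h0).1
  -- After cancelling the greatest common divisor, `d'` divides the lower left block of `P`.
  have hblock : ∀ i j, r ≤ i → j ≤ r → d' ∣ P i j := by
    intro i j hi hj
    have hentry : P i j * e j = d i * Q i j := by
      simpa only [mul_diagonal, diagonal_mul] using congrFun (congrFun h i) j
    have hdvd : d r ∣ P i j * e r :=
      ((hd r i hi).trans ⟨Q i j, hentry⟩).trans (mul_dvd_mul_left _ (he j r hj))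
    have hcancel : d' ∣ P i j * e' := by
      rwa [← mul_dvd_mul_iff_left hgcd, ← hd', mul_left_comm, ← he']
    exact (gcd_isUnit_iff_isRelPrime.1 hcoprime).dvd_of_dvd_mul_right hcancel
  -- This block is too large for a permutation to avoid it.
  have hperm : ∀ σ : Equiv.Perm ι, ∃ j, j ≤ r ∧ r ≤ σ j := by
    intro σ
    by_contra! hlt
    have hcard := Finset.card_le_card_of_injOn (s := Finset.Iic r) (t := Finset.Iio r) σ
      (fun j hj => by simpa using hlt j (by simpa using hj)) σ.injective.injOn
    exact hcard.not_gt (Finset.card_lt_card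
      (Finset.ssubset_iff_of_subset Finset.Iio_subset_Iic_self |>.2 ⟨r, by simp, by simp⟩))
  have hdet : d' ∣ P.det := by
    rw [det_apply]
    refine Finset.dvd_sum fun σ _ => ?_
    obtain ⟨j, hj, hσ⟩ := hperm σ
    rw [Units.smul_def, zsmul_eq_mul]
    exact Dvd.dvd.mul_left ((hblock _ _ hσ hj).trans
      (Finset.dvd_prod_of_mem (fun i => P (σ i) i) (Finset.mem_univ j))) _
  have hunit : IsUnit d' := isUnit_of_dvd_unit hdet hP
  rw [hd', hunit.mul_right_dvd]
  exact gcd_dvd_right _ _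

theorem dvd_of_mul_diagonal_mul_eq {ι R : Type*} [Fintype ι] [LinearOrder ι]
    [LocallyFiniteOrderBot ι] [CommRing R] [IsDomain R] [GCDMonoid R] {d e : ι → R}
    (hd : ∀ i j, i ≤ j → d i ∣ d j) (he : ∀ i j, i ≤ j → e i ∣ e j)
    {B₁ B₂ B₃ B₄ : Matrix ι ι R} (h₁ : IsUnit B₁.det) (h₃ : IsUnit B₃.det) (h₄ : IsUnit B₄.det)
    (h : B₁ * diagonal d * B₂ = B₃ * diagonal e * B₄) {r : ι} (hr : d r ≠ 0) : d r ∣ e r := by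
  refine dvd_of_mul_diagonal_eq_diagonal_mul hd he (P := B₁⁻¹ * B₃) (Q := B₂ * B₄⁻¹) ?_ ?_ hr
  · rw [det_mul]
    exact (isUnit_nonsing_inv_det _ h₁).mul h₃
  · calc B₁⁻¹ * B₃ * diagonal e
        = B₁⁻¹ * (B₃ * diagonal e * B₄) * B₄⁻¹ := by
          rw [← mul_assoc, ← mul_assoc, mul_nonsing_inv_cancel_right _ _ h₄]
      _ = diagonal d * (B₂ * B₄⁻¹) := by
          rw [← h, mul_assoc B₁, nonsing_inv_mul_cancel_left _ _ h₁, mul_assoc]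

theorem charpoly_comp_neg_X {ι R : Type*} [Fintype ι] [DecidableEq ι] [CommRing R]
    (A : Matrix ι ι R) : A.charpoly.comp (-X) = (-1) ^ Fintype.card ι * (-A).charpoly := by
  have hcharmatrix : (compRingHom (-X)).mapMatrix A.charmatrix = -(-A).charmatrix := by
    ext i j : 2
    obtain rfl | hij := eq_or_ne i j
    · simp [sub_eq_add_neg, add_comm]
    · simp [hij]
  rw [← coe_compRingHom_apply, charpoly, RingHom.map_det, hcharmatrix, det_neg, charpoly]

variable {K : Type*} [Field K]

theorem isSkew_of_monic_of_dvd_comp_neg_X {d : K[X]} (hd : d.Monic) (h : d ∣ d.comp (-X)) :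
    IsSkew d := by
  have heq : (-1) ^ d.natDegree * d.comp (-X) = d := by
    refine eq_of_monic_of_dvd_of_natDegree_le hd hd.neg_one_pow_natDegree_mul_comp_neg_X
      (h.mul_left _) ?_
    simpa [natDegree_comp] using natDegree_mul_le (p := (-1 : K[X]) ^ d.natDegree)
      (q := d.comp (-X))
  rw [IsSkew]
  nth_rw 3 [← heq]
  rw [← mul_assoc, ← mul_pow, neg_mul_neg, one_mul, one_pow, one_mul]

section SkewAdjoint

variable {ι : Type*} [Fintype ι] [DecidableEq ι] {S A : Matrix ι ι K}

theorem mul_mul_inv_eq_neg_transpose (hS : S.det ≠ 0) (h : S.IsSkewAdjoint A) :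
    S * A * S⁻¹ = -Aᵀ := by
  rw [← neg_eq_iff_eq_neg, ← neg_mul, ← mul_neg, ← h,
    mul_nonsing_inv_cancel_right _ _ (isUnit_iff_ne_zero.2 hS)]

theorem isSkew_charpoly (hS : S.det ≠ 0) (h : S.IsSkewAdjoint A) : IsSkew A.charpoly := by
  have hneg : A.charpoly = (-A).charpoly := by
    obtain ⟨u, rfl⟩ := (isUnit_iff_isUnit_det S).2 (isUnit_iff_ne_zero.2 hS)
    rw [← charpoly_units_conj u A, ← charpoly_transpose (-A), transpose_neg,
      ← mul_mul_inv_eq_neg_transpose hS h]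
  rw [IsSkew, charpoly_comp_neg_X, ← hneg, charpoly_natDegree_eq_dim]

theorem trace_eq_zero [CharZero K] (hS : S.det ≠ 0) (h : S.IsSkewAdjoint A) : A.trace = 0 := by
  have htrace := congrArg trace (mul_mul_inv_eq_neg_transpose hS h)
  rw [trace_mul_comm, nonsing_inv_mul_cancel_left _ _ (isUnit_iff_ne_zero.2 hS), trace_neg,
    trace_transpose] at htrace
  exact self_eq_neg.1 htrace

theorem det_eq_zero [CharZero K] (hS : S.det ≠ 0) (h : S.IsSkewAdjoint A)
    (hι : Odd (Fintype.card ι)) : A.det = 0 := by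
  have hdet := congrArg det (mul_mul_inv_eq_neg_transpose hS h)
  rw [det_mul_comm, nonsing_inv_mul_cancel_left _ _ (isUnit_iff_ne_zero.2 hS), det_neg,
    det_transpose, hι.neg_one_pow, neg_one_mul] at hdet
  exact self_eq_neg.1 hdet

theorem map_C_mul_sub_scalar_X (h : S.IsSkewAdjoint A) :
    S.map C * (A.map C - scalar ι X) = -(A.map C + scalar ι X)ᵀ * S.map C := by
  have hmap : S.map C * A.map C = -(A.map C)ᵀ * S.map C := by
    have hSA : S * A = -(Aᵀ * S) := by rw [h, mul_neg, neg_neg]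
    rw [← Matrix.map_mul, hSA, Matrix.map_neg _ (fun _ => C_neg), Matrix.map_mul, transpose_map,
      neg_mul]
  have hscalar : S.map C * scalar ι X = scalar ι X * S.map C :=
    (scalar_commute (X : K[X]) (mul_comm _) (S.map C)).eq.symm
  rw [mul_sub, hmap, hscalar, transpose_add, neg_add, add_mul, sub_eq_add_neg, neg_mul, neg_mul,
    scalar_apply, diagonal_transpose]

end SkewAdjoint

theorem isSkew_of_isInvariantFactors {m : ℕ} {S A : Matrix (Fin m) (Fin m) K} (hS : S.det ≠ 0)
    (h : S.IsSkewAdjoint A) {d : Fin m → K[X]} (hd : IsInvariantFactors A d) (i : Fin m) :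
    IsSkew (d i) := by
  obtain ⟨hmonic, hdvd, C₁, C₂, hC₁, hC₂, hA⟩ := hd
  refine isSkew_of_monic_of_dvd_comp_neg_X (hmonic i) ?_
  let := UniqueFactorizationMonoid.toGCDMonoid K[X]
  let ν : K[X] →+* K[X] := compRingHom (-X)
  have hS' : IsUnit (S.map C).det := by
    rw [← RingHom.mapMatrix_apply, ← RingHom.map_det]
    exact (isUnit_iff_ne_zero.2 hS).map C
  have hν : ∀ M : Matrix (Fin m) (Fin m) K[X], IsUnit M.det → IsUnit (M.map ν).det := by
    intro M hM
    rw [← RingHom.mapMatrix_apply, ← RingHom.map_det]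
    exact hM.map ν
  -- The substitution `λ ↦ -λ` turns the Smith form of `A - λ` into one of `A + λ`.
  have hνA : A.map C + scalar (Fin m) X = C₁.map ν * diagonal (ν ∘ d) * C₂.map ν := by
    have hmap := congrArg (fun M : Matrix (Fin m) (Fin m) K[X] => M.map ν) hA
    simp only [Matrix.map_mul, diagonal_map (map_zero ν)] at hmap
    refine Eq.trans ?_ hmap
    ext a b : 2
    obtain rfl | hab := eq_or_ne a b
    · simp [ν]
    · simp [ν, hab]
  refine dvd_of_mul_diagonal_mul_eq (e := ν ∘ d) (B₁ := S.map C * C₁) (B₂ := C₂)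
    (B₃ := -(C₂.map ν)ᵀ) (B₄ := (C₁.map ν)ᵀ * S.map C) hdvd
    (fun i j hij => map_dvd ν (hdvd i j hij)) ?_ ?_ ?_ ?_ (hmonic i).ne_zero
  · rw [det_mul]
    exact hS'.mul hC₁
  · rw [det_neg, det_transpose]
    exact (isUnit_one.neg.pow _).mul (hν C₂ hC₂)
  · rw [det_mul, det_transpose]
    exact (hν C₁ hC₁).mul hS'
  · have hkey := map_C_mul_sub_scalar_X h
    rw [hA, hνA, transpose_mul, transpose_mul, diagonal_transpose] at hkey
    simpa only [mul_assoc, neg_mul] using hkey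

end LinearAlgebra

section MultiIndex

variable {n : ℕ}

@[elab_as_elim]
theorem multiIndex_induction {ι : Type*} {p : (ι →₀ ℕ) → Prop} (I : ι →₀ ℕ) (zero : p 0)
    (add_single : ∀ I j, p I → p (I + Finsupp.single j 1)) : p I := by
  induction I using Finsupp.induction with
  | zero => exact zero
  | single_add j b I _ hb ih =>
    clear hb
    induction b with
    | zero => simpa using ih
    | succ b ihb =>
      rw [Finsupp.single_add, add_right_comm]
      exact add_single _ _ ihb

theorem exists_eq_add_single {ι : Type*} {I : ι →₀ ℕ} {j : ι} (h : I j ≠ 0) :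
    ∃ I', I = I' + Finsupp.single j 1 :=
  ⟨I - Finsupp.single j 1, (Finsupp.sub_add_single_one_cancel h).symm⟩

theorem add_single_apply_of_ne {ι : Type*} (I : ι →₀ ℕ) {i j : ι} (hij : i ≠ j) :
    (I + Finsupp.single j 1 : ι →₀ ℕ) i = I i := by
  simp [hij.symm]

theorem prod_choose_add_single {ι : Type*} [Fintype ι] (I K : ι →₀ ℕ) (j : ι) :
    ∏ i, ((I + Finsupp.single j 1 : ι →₀ ℕ) i).choose ((K + Finsupp.single j 1 : ι →₀ ℕ) i) =
      ∏ i, (I i).choose (K i) + ∏ i, (I i).choose ((K + Finsupp.single j 1 : ι →₀ ℕ) i) := by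
  classical
  simp only [← Finset.mul_prod_erase Finset.univ _ (Finset.mem_univ j)]
  have hrest : ∀ i ∈ Finset.univ.erase j,
      ((I + Finsupp.single j 1 : ι →₀ ℕ) i).choose ((K + Finsupp.single j 1 : ι →₀ ℕ) i) =
        (I i).choose (K i) ∧
      (I i).choose ((K + Finsupp.single j 1 : ι →₀ ℕ) i) = (I i).choose (K i) := fun i hi => by
    have hij := Finset.ne_of_mem_erase hi
    rw [add_single_apply_of_ne I hij, add_single_apply_of_ne K hij]
    exact ⟨rfl, rfl⟩
  rw [Finset.prod_congr rfl fun i hi => (hrest i hi).1,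
    Finset.prod_congr rfl fun i hi => (hrest i hi).2, ← add_mul]
  simp [Nat.choose_succ_succ]

/-- The multi-index power `a₁ ^ I₁ * ⋯ * aₙ ^ Iₙ` of a family of elements of a monoid, meant for
pairwise commuting families. -/
def multiPow {M : Type*} [Monoid M] (a : Fin n → M) (I : Fin n →₀ ℕ) : M :=
  ((List.finRange n).map fun j => a j ^ I j).prod

variable {M : Type*} [Monoid M] {a : Fin n → M}

@[simp]
theorem multiPow_zero : multiPow a 0 = 1 := by
  simp [multiPow]

theorem list_prod_map_pow_add_single (ha : ∀ i j, Commute (a i) (a j)) (j : Fin n)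
    (I : Fin n →₀ ℕ) {l : List (Fin n)} (hl : l.Nodup) :
    (l.map fun k => a k ^ (I + Finsupp.single j 1 : Fin n →₀ ℕ) k).prod =
      (if j ∈ l then a j else 1) * (l.map fun k => a k ^ I k).prod := by
  induction l with
  | nil => simp
  | cons k l ih =>
    obtain ⟨hk, hl⟩ := List.nodup_cons.1 hl
    rw [List.map_cons, List.prod_cons, ih hl, List.map_cons, List.prod_cons]
    obtain rfl | hjk := eq_or_ne j k
    · simp [hk, pow_succ', mul_assoc]
    · rw [add_single_apply_of_ne I hjk.symm]
      by_cases hj : j ∈ l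
      · simp only [hj, if_true, List.mem_cons, or_true, ← mul_assoc, ((ha j k).pow_right _).eq]
      · simp [hj, hjk]

theorem multiPow_add_single (ha : ∀ i j, Commute (a i) (a j)) (I : Fin n →₀ ℕ) (j : Fin n) :
    multiPow a (I + Finsupp.single j 1) = a j * multiPow a I := by
  simpa [multiPow] using list_prod_map_pow_add_single ha j I (List.nodup_finRange n)

end MultiIndex

/-- Differential operators `∑ a_I D^I` in `n` commuting derivations `D₁, …, Dₙ` of `R`, encoded by
their full symbols `∑ a_I q^I`. The product of polynomials is not the composition of operators,
which is `DiffOp.comp`. -/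
abbrev DiffOp (n : ℕ) (R : Type*) [CommRing R] : Type _ := MvPolynomial (Fin n) R

namespace DiffOp

open MvPolynomial

variable {n : ℕ} {k R A : Type*} [CommRing k] [CommRing R] [Algebra k R] [AddCommGroup A]
  [Module k A]

/-- The linear map on differential operators with prescribed values `b I a` on the operators
`a D^I`. -/
def lift (b : (Fin n →₀ ℕ) → R →ₗ[k] A) : DiffOp n R →ₗ[k] A :=
  Finsupp.lsum k b ∘ₗ (AddMonoidAlgebra.coeffLinearEquiv k).toLinearMap

theorem lift_apply (b : (Fin n →₀ ℕ) → R →ₗ[k] A) (P : DiffOp n R) :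
    lift b P = ∑ I ∈ P.support, b I (P.coeff I) :=
  sum_def

@[simp]
theorem lift_monomial (b : (Fin n →₀ ℕ) → R →ₗ[k] A) (I : Fin n →₀ ℕ) (a : R) :
    lift b (monomial I a) = b I a :=
  sum_monomial_eq (map_zero _)

/-- The coefficientwise extension of a linear map to differential operators. -/
def mapCoeff (T : R →ₗ[k] R) : Module.End k (DiffOp n R) :=
  lift fun I => (monomial I).restrictScalars k ∘ₗ T

@[simp]
theorem mapCoeff_monomial (T : R →ₗ[k] R) (I : Fin n →₀ ℕ) (a : R) :
    mapCoeff T (monomial I a) = monomial I (T a) := by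
  simp [mapCoeff]

@[simp]
theorem coeff_mapCoeff (T : R →ₗ[k] R) (I : Fin n →₀ ℕ) (P : DiffOp n R) :
    (mapCoeff T P).coeff I = T (P.coeff I) := by
  classical
  induction P using MvPolynomial.induction_on' with
  | monomial J a => simp only [mapCoeff_monomial, coeff_monomial, apply_ite T, map_zero]
  | add P Q hP hQ => simp only [map_add, coeff_add, hP, hQ]

theorem homogeneousComponent_mapCoeff (T : R →ₗ[k] R) (b : ℕ) (P : DiffOp n R) :
    homogeneousComponent b (mapCoeff T P) = mapCoeff T (homogeneousComponent b P) := by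
  ext I
  simp only [coeff_homogeneousComponent, coeff_mapCoeff, apply_ite T, map_zero]

theorem totalDegree_mapCoeff_le (T : R →ₗ[k] R) (P : DiffOp n R) :
    (mapCoeff T P).totalDegree ≤ P.totalDegree :=
  totalDegree_le_of_support_subset fun I hI => by
    rw [mem_support_iff, coeff_mapCoeff] at hI
    exact mem_support_iff.2 fun h => hI (by rw [h, map_zero])

theorem homogeneousComponent_X_mul (j : Fin n) (b : ℕ) (P : DiffOp n R) :
    homogeneousComponent (b + 1) (X j * P) = X j * homogeneousComponent b P := by
  classical
  ext I
  rw [coeff_homogeneousComponent, coeff_X_mul', coeff_X_mul']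
  by_cases hj : j ∈ I.support
  · obtain ⟨I, rfl⟩ := exists_eq_add_single (Finsupp.mem_support_iff.1 hj)
    simp only [hj, if_true, add_tsub_cancel_right, coeff_homogeneousComponent, map_add,
      Finsupp.degree_single, add_left_inj]
  · simp only [hj, if_false, ite_self]

variable (D : Fin n → Derivation k R R)

/-- The iterated derivation `D^I`. -/
def iter (I : Fin n →₀ ℕ) : Module.End k R :=
  multiPow (fun j => (D j : Module.End k R)) I

/-- The composition `D_j ∘ P`. -/
def deriv (j : Fin n) : Module.End k (DiffOp n R) :=
  LinearMap.mulLeft k (X j) + mapCoeff (D j : R →ₗ[k] R)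

/-- The composition `D^I ∘ P`. -/
def iterDeriv (I : Fin n →₀ ℕ) : Module.End k (DiffOp n R) :=
  multiPow (deriv D) I

/-- The composition `P ∘ Q`, as a linear map in `P`. -/
def comp (Q : DiffOp n R) : Module.End k (DiffOp n R) :=
  lift fun I => (LinearMap.toSpanSingleton R _ (iterDeriv D I Q)).restrictScalars k

/-- The action `g ↦ ∑ a_I D^I g` of the operator `∑ a_I D^I`. -/
def toEnd : DiffOp n R →ₗ[k] Module.End k R :=
  lift fun I => (LinearMap.mul k R).compl₂ (iter D I)

/-- The action `g ↦ ∑ (-1)^|I| D^I (a_I g)` of the formal adjoint of the operator `∑ a_I D^I`. -/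
def adjointEnd : DiffOp n R →ₗ[k] Module.End k R :=
  lift fun I => (-1 : k) ^ I.degree • (LinearMap.mul k R).compr₂ (iter D I)

/-- The formal adjoint `∑ (-1)^|I| D^I ∘ a_I` of `∑ a_I D^I`. -/
def adjoint : Module.End k (DiffOp n R) :=
  lift fun I => (-1 : k) ^ I.degree • iterDeriv D I ∘ₗ (monomial 0).restrictScalars k

@[simp]
theorem iter_zero (f : R) : iter D 0 f = f := by
  simp [iter]

@[simp]
theorem iterDeriv_zero (P : DiffOp n R) : iterDeriv D 0 P = P := by
  simp [iterDeriv]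

@[simp]
theorem deriv_monomial (j : Fin n) (I : Fin n →₀ ℕ) (a : R) :
    deriv D j (monomial I a) = monomial (I + Finsupp.single j 1) a + monomial I (D j a) := by
  simp [deriv, X, monomial_mul, add_comm]

theorem coeff_deriv_of_eq_zero {j : Fin n} {I : Fin n →₀ ℕ} (h : I j = 0) (P : DiffOp n R) :
    (deriv D j P).coeff I = D j (P.coeff I) := by
  classical
  simp [deriv, coeff_X_mul', h]

theorem coeff_add_single_deriv (j : Fin n) (I : Fin n →₀ ℕ) (P : DiffOp n R) :
    (deriv D j P).coeff (I + Finsupp.single j 1) =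
      P.coeff I + D j (P.coeff (I + Finsupp.single j 1)) := by
  simp [deriv, add_comm I]

theorem totalDegree_deriv_le (j : Fin n) (P : DiffOp n R) :
    (deriv D j P).totalDegree ≤ P.totalDegree + 1 := by
  refine (totalDegree_add _ _).trans (max_le ?_ ?_)
  · refine (totalDegree_mul _ _).trans ?_
    rw [add_comm]
    exact Nat.add_le_add_left ((totalDegree_monomial_le _ _).trans (by simp)) _
  · exact (totalDegree_mapCoeff_le _ P).trans (Nat.le_succ _)

theorem homogeneousComponent_deriv (j : Fin n) {b : ℕ} {P : DiffOp n R}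
    (hP : P.totalDegree ≤ b) :
    homogeneousComponent (b + 1) (deriv D j P) = X j * homogeneousComponent b P := by
  rw [deriv, LinearMap.add_apply, map_add, LinearMap.mulLeft_apply, homogeneousComponent_X_mul,
    homogeneousComponent_eq_zero _ _
      ((totalDegree_mapCoeff_le _ P).trans_lt (Nat.lt_succ_of_le hP)), add_zero]

@[simp]
theorem comp_monomial (Q : DiffOp n R) (I : Fin n →₀ ℕ) (a : R) :
    comp D Q (monomial I a) = a • iterDeriv D I Q := by
  simp [comp]

theorem coeff_comp (P Q : DiffOp n R) (I : Fin n →₀ ℕ) :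
    (comp D Q P).coeff I = ∑ K ∈ P.support, P.coeff K * (iterDeriv D K Q).coeff I := by
  rw [comp, lift_apply, coeff_sum]
  rfl

@[simp]
theorem toEnd_monomial (I : Fin n →₀ ℕ) (a g : R) :
    toEnd D (monomial I a) g = a * iter D I g := by
  simp [toEnd]

@[simp]
theorem adjointEnd_monomial (I : Fin n →₀ ℕ) (a g : R) :
    adjointEnd D (monomial I a) g = (-1 : k) ^ I.degree • iter D I (a * g) := by
  simp [adjointEnd]

theorem adjointEnd_apply (P : DiffOp n R) (g : R) :
    adjointEnd D P g = ∑ᶠ I, (-1 : k) ^ I.degree • iter D I (P.coeff I * g) := by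
  rw [adjointEnd, lift_apply, LinearMap.sum_apply]
  refine (finsum_eq_sum_of_support_subset _ fun I hI => mem_support_iff.2 fun h => hI ?_).symm
  simp only [h, map_zero, LinearMap.zero_apply]

@[simp]
theorem adjointEnd_C (a g : R) : adjointEnd D (C a) g = a * g := by
  rw [← monomial_zero', adjointEnd_monomial]
  simp

@[simp]
theorem toEnd_C (a g : R) : toEnd D (C a) g = a * g := by
  rw [← monomial_zero', toEnd_monomial, iter_zero]

theorem adjointEnd_smul (a : R) (P : DiffOp n R) (g : R) :
    adjointEnd D (a • P) g = adjointEnd D P (a * g) := by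
  induction P using MvPolynomial.induction_on' with
  | monomial I b =>
    rw [smul_monomial, adjointEnd_monomial, adjointEnd_monomial, smul_eq_mul, mul_comm a,
      mul_assoc]
  | add P Q hP hQ => simp only [smul_add, map_add, LinearMap.add_apply, hP, hQ]

@[simp]
theorem adjoint_monomial (I : Fin n →₀ ℕ) (a : R) :
    adjoint D (monomial I a) = (-1 : k) ^ I.degree • iterDeriv D I (C a) :=
  lift_monomial _ I a

variable {D} (hD : ∀ i j f, D i (D j f) = D j (D i f))

include hD

theorem iter_add_single (I : Fin n →₀ ℕ) (j : Fin n) (f : R) :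
    iter D (I + Finsupp.single j 1) f = D j (iter D I f) := by
  rw [iter, multiPow_add_single fun i j => LinearMap.ext (hD i j)]
  rfl

theorem derivation_iter {T : Derivation k R R} (hT : ∀ j f, T (D j f) = D j (T f))
    (I : Fin n →₀ ℕ) (f : R) : T (iter D I f) = iter D I (T f) := by
  induction I using multiIndex_induction with
  | zero => simp
  | add_single I j ih => rw [iter_add_single hD, iter_add_single hD, hT, ih]

theorem deriv_comm (i j : Fin n) : Commute (deriv D i) (deriv D j) := by
  refine LinearMap.ext fun P => ?_
  simp only [Module.End.mul_apply]
  induction P using MvPolynomial.induction_on' with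
  | monomial I a =>
    simp only [deriv_monomial, map_add, hD i j, add_right_comm I]
    abel
  | add P Q hP hQ => simp only [map_add, hP, hQ]

theorem iterDeriv_add_single (I : Fin n →₀ ℕ) (j : Fin n) (P : DiffOp n R) :
    iterDeriv D (I + Finsupp.single j 1) P = deriv D j (iterDeriv D I P) := by
  rw [iterDeriv, multiPow_add_single (deriv_comm hD)]
  rfl

theorem totalDegree_iterDeriv_le (I : Fin n →₀ ℕ) (P : DiffOp n R) :
    (iterDeriv D I P).totalDegree ≤ I.degree + P.totalDegree := by
  induction I using multiIndex_induction with
  | zero => simp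
  | add_single I j ih =>
    rw [iterDeriv_add_single hD, map_add, Finsupp.degree_single, add_right_comm]
    exact (totalDegree_deriv_le D j _).trans (Nat.add_le_add_right ih 1)

theorem homogeneousComponent_iterDeriv (I : Fin n →₀ ℕ) {b : ℕ} {P : DiffOp n R}
    (hP : P.totalDegree ≤ b) :
    homogeneousComponent (I.degree + b) (iterDeriv D I P) =
      monomial I 1 * homogeneousComponent b P := by
  induction I using multiIndex_induction with
  | zero => simp
  | add_single I j ih =>
    rw [iterDeriv_add_single hD, map_add, Finsupp.degree_single, add_right_comm,
      homogeneousComponent_deriv D j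
        ((totalDegree_iterDeriv_le hD I P).trans (Nat.add_le_add_left hP _)), ih,
      monomial_add_single, pow_one, mul_left_comm, mul_assoc]

theorem totalDegree_comp_le (P Q : DiffOp n R) :
    (comp D Q P).totalDegree ≤ P.totalDegree + Q.totalDegree := by
  rw [comp, lift_apply]
  refine totalDegree_finsetSum_le fun I hI => (totalDegree_smul_le _ _).trans ?_
  exact (totalDegree_iterDeriv_le hD I Q).trans
    (Nat.add_le_add_right (le_totalDegree hI) _)

theorem homogeneousComponent_comp {a b : ℕ} {P Q : DiffOp n R} (hP : P.totalDegree ≤ a)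
    (hQ : Q.totalDegree ≤ b) :
    homogeneousComponent (a + b) (comp D Q P) =
      homogeneousComponent a P * homogeneousComponent b Q := by
  rw [comp, lift_apply, map_sum, homogeneousComponent_apply, Finset.sum_mul, Finset.sum_filter]
  refine Finset.sum_congr rfl fun I hI => ?_
  change homogeneousComponent (a + b) (P.coeff I • iterDeriv D I Q) = _
  rw [map_smul]
  split_ifs with hIa
  · rw [← hIa, homogeneousComponent_iterDeriv hD I hQ, ← smul_mul_assoc, smul_monomial,
      smul_eq_mul, mul_one]
  · have hlt : I.degree < a := ((le_totalDegree hI).trans hP).lt_of_ne hIa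
    rw [homogeneousComponent_eq_zero, smul_zero]
    exact (totalDegree_iterDeriv_le hD I Q).trans_lt (Nat.add_lt_add_of_lt_of_le hlt hQ)

theorem adjointEnd_deriv (j : Fin n) (P : DiffOp n R) (g : R) :
    adjointEnd D (deriv D j P) g = -adjointEnd D P (D j g) := by
  induction P using MvPolynomial.induction_on' with
  | monomial I a =>
    simp only [deriv_monomial, map_add, LinearMap.add_apply, adjointEnd_monomial,
      Finsupp.degree_single, pow_succ, mul_neg_one, neg_smul, iter_add_single hD,
      derivation_iter hD (hD j), Derivation.leibniz, smul_eq_mul, mul_comm (D j a), smul_add]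
    abel
  | add P Q hP hQ => simp only [map_add, LinearMap.add_apply, hP, hQ, neg_add]

theorem adjointEnd_iterDeriv (I : Fin n →₀ ℕ) (P : DiffOp n R) (g : R) :
    adjointEnd D (iterDeriv D I P) g = (-1 : k) ^ I.degree • adjointEnd D P (iter D I g) := by
  induction I using multiIndex_induction generalizing g with
  | zero => simp
  | add_single I j ih =>
    rw [iterDeriv_add_single hD, adjointEnd_deriv hD, ih, iter_add_single hD, map_add,
      Finsupp.degree_single, pow_succ, mul_neg_one, neg_smul, derivation_iter hD (hD j)]

theorem adjointEnd_comp (P Q : DiffOp n R) (g : R) :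
    adjointEnd D (comp D Q P) g = adjointEnd D Q (adjointEnd D P g) := by
  induction P using MvPolynomial.induction_on' with
  | monomial I a =>
    rw [comp_monomial, adjointEnd_smul, adjointEnd_iterDeriv hD, adjointEnd_monomial, map_smul]
  | add P P' hP hP' => simp only [map_add, LinearMap.add_apply, hP, hP']

theorem adjointEnd_mapCoeff_one {T : Derivation k R R} (hT : ∀ j f, T (D j f) = D j (T f))
    (P : DiffOp n R) : adjointEnd D (mapCoeff (T : R →ₗ[k] R) P) 1 = T (adjointEnd D P 1) := by
  induction P using MvPolynomial.induction_on' with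
  | monomial I a => simp [derivation_iter hD hT]
  | add P Q hP hQ => simp only [map_add, LinearMap.add_apply, hP, hQ]

theorem toEnd_deriv (j : Fin n) (P : DiffOp n R) (g : R) :
    toEnd D (deriv D j P) g = D j (toEnd D P g) := by
  induction P using MvPolynomial.induction_on' with
  | monomial I a => simp [iter_add_single hD, mul_comm (iter D I g)]
  | add P Q hP hQ => simp only [map_add, LinearMap.add_apply, hP, hQ]

theorem toEnd_iterDeriv (I : Fin n →₀ ℕ) (P : DiffOp n R) (g : R) :
    toEnd D (iterDeriv D I P) g = iter D I (toEnd D P g) := by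
  induction I using multiIndex_induction with
  | zero => simp
  | add_single I j ih => rw [iterDeriv_add_single hD, toEnd_deriv hD, ih, iter_add_single hD]

theorem toEnd_adjoint (P : DiffOp n R) (g : R) :
    toEnd D (adjoint D P) g = adjointEnd D P g := by
  induction P using MvPolynomial.induction_on' with
  | monomial I a =>
    rw [adjoint_monomial, map_smul, LinearMap.smul_apply, toEnd_iterDeriv hD, toEnd_C,
      adjointEnd_monomial]
  | add P Q hP hQ => simp only [map_add, LinearMap.add_apply, hP, hQ]

theorem totalDegree_iterDeriv_C_le (I : Fin n →₀ ℕ) (a : R) :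
    (iterDeriv D I (C a)).totalDegree ≤ I.degree := by
  simpa using totalDegree_iterDeriv_le hD I (C a)

theorem totalDegree_adjoint_le (P : DiffOp n R) :
    (adjoint D P).totalDegree ≤ P.totalDegree := by
  rw [adjoint, lift_apply]
  exact totalDegree_finsetSum_le fun I hI => (totalDegree_smul_le _ _).trans <|
    (totalDegree_iterDeriv_C_le hD I _).trans (le_totalDegree hI)

theorem homogeneousComponent_adjoint {b : ℕ} {P : DiffOp n R} (hP : P.totalDegree ≤ b) :
    homogeneousComponent b (adjoint D P) = (-1 : k) ^ b • homogeneousComponent b P := by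
  rw [adjoint, lift_apply, map_sum, homogeneousComponent_apply, Finset.smul_sum,
    Finset.sum_filter]
  refine Finset.sum_congr rfl fun I hI => ?_
  change homogeneousComponent b ((-1 : k) ^ I.degree • iterDeriv D I (C (P.coeff I))) = _
  rw [LinearMap.map_smul_of_tower]
  split_ifs with hIb
  · have htop := homogeneousComponent_iterDeriv hD I (totalDegree_C (P.coeff I)).le
    rw [add_zero, homogeneousComponent_zero, coeff_C, if_pos rfl, mul_comm, C_mul_monomial,
      mul_one] at htop
    rw [← hIb, htop]
  · rw [homogeneousComponent_eq_zero, smul_zero]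
    exact (totalDegree_iterDeriv_C_le hD I _).trans_lt (((le_totalDegree hI).trans hP).lt_of_ne hIb)

theorem coeff_iterDeriv_C (I K : Fin n →₀ ℕ) (a : R) :
    (iterDeriv D I (C a)).coeff K = (∏ j, (I j).choose (K j)) • iter D (I - K) a := by
  classical
  induction I using multiIndex_induction generalizing K with
  | zero =>
    rw [iterDeriv_zero, zero_tsub, iter_zero, coeff_C]
    split_ifs with hK
    · simp [← hK]
    · obtain ⟨j, hj⟩ := Finsupp.ne_iff.1 (Ne.symm hK)
      rw [Finset.prod_eq_zero (Finset.mem_univ j), zero_smul]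
      exact Nat.choose_eq_zero_of_lt (Nat.pos_of_ne_zero hj)
  | add_single I j ih =>
    rw [iterDeriv_add_single hD]
    by_cases hK : K j = 0
    · have hsub : I + Finsupp.single j 1 - K = I - K + Finsupp.single j 1 := by
        ext i
        obtain rfl | hij := eq_or_ne j i <;> simp [*]
      rw [coeff_deriv_of_eq_zero D hK, ih, map_nsmul, hsub, iter_add_single hD]
      congr 1
      refine Finset.prod_congr rfl fun i _ => ?_
      obtain rfl | hij := eq_or_ne j i <;> simp [*]
    · obtain ⟨K, rfl⟩ := exists_eq_add_single hK
      rw [coeff_add_single_deriv, ih, ih, prod_choose_add_single, add_smul,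
        add_tsub_add_eq_tsub_right, map_nsmul, ← iter_add_single hD]
      congr 1
      obtain hle | hlt := le_or_gt (K j + 1) (I j)
      · have hsub : I - (K + Finsupp.single j 1) + Finsupp.single j 1 = I - K := by
          rw [← tsub_tsub, Finsupp.sub_add_single_one_cancel]
          simpa using Nat.sub_ne_zero_of_lt hle
        rw [hsub]
      · rw [Finset.prod_eq_zero (Finset.mem_univ j), zero_smul, zero_smul]
        exact Nat.choose_eq_zero_of_lt (by simpa using hlt)

theorem coeff_adjoint (P : DiffOp n R) (K : Fin n →₀ ℕ) :
    (adjoint D P).coeff K = ∑ᶠ I : Fin n →₀ ℕ, (-1 : k) ^ (K + I).degree •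
      (∏ j, ((K + I) j).choose (K j)) • iter D I (P.coeff (K + I)) := by
  let f (I : Fin n →₀ ℕ) : R :=
    (-1 : k) ^ I.degree • (∏ j, (I j).choose (K j)) • iter D (I - K) (P.coeff I)
  have hf : ∀ I, f I ≠ 0 → K ≤ I := fun I hI j => by
    by_contra hlt
    refine hI ?_
    simp only [f]
    rw [Finset.prod_eq_zero (Finset.mem_univ j) (Nat.choose_eq_zero_of_lt (not_le.1 hlt)),
      zero_smul, smul_zero]
  calc (adjoint D P).coeff K = ∑ I ∈ P.support, f I := by
        rw [adjoint, lift_apply, coeff_sum]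
        refine Finset.sum_congr rfl fun I _ => ?_
        change coeff K ((-1 : k) ^ I.degree • iterDeriv D I (C (P.coeff I))) = _
        rw [coeff_smul, coeff_iterDeriv_C hD]
    _ = ∑ᶠ I, f I := by
        refine (finsum_eq_sum_of_support_subset _ fun I hI => mem_support_iff.2 fun h => hI ?_).symm
        simp only [f, h, map_zero, smul_zero]
    _ = ∑ᶠ I ∈ Set.range (K + ·), f I := by
        refine finsum_congr fun I => ?_
        by_cases hI : f I = 0
        · simp [hI]
        · classical
          rw [finsum_eq_if, if_pos ⟨I - K, add_tsub_cancel_of_le (hf I hI)⟩]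
    _ = ∑ᶠ I, f (K + I) := finsum_mem_range (add_right_injective K)
    _ = _ := by simp only [f, add_tsub_cancel_left]

end DiffOp

section CoordSums

variable {n m h : ℕ}

theorem Coord.u_injective :
    Function.Injective fun c : Fin h × Fin m × (Fin n →₀ ℕ) =>
      (Coord.u c.1 c.2.1 c.2.2 : Coord n m h) := by
  rintro ⟨s, i, I⟩ ⟨s', i', I'⟩ h
  simpa using h

theorem Coord.finsum_eq {M : Type*} [AddCommMonoid M] (φ : Coord n m h → M)
    (hφ : (Function.support φ).Finite) :
    ∑ᶠ c, φ c = φ .t + ∑ j, φ (.x j) +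
      ∑ᶠ c : Fin h × Fin m × (Fin n →₀ ℕ), φ (.u c.1 c.2.1 c.2.2) := by
  have hu : (Set.univ : Set (Coord n m h)) = ({.t} ∪ Set.range .x) ∪
      Set.range fun c : Fin h × Fin m × (Fin n →₀ ℕ) => .u c.1 c.2.1 c.2.2 := by
    ext c
    cases c <;> simp
  have hx : Function.Injective (Coord.x : Fin n → Coord n m h) := fun i j h => by simpa using h
  rw [← finsum_mem_univ, hu, finsum_mem_union' ?_ (hφ.inter_of_right _) (hφ.inter_of_right _),
    finsum_mem_union' ?_ (hφ.inter_of_right _) (hφ.inter_of_right _), finsum_mem_singleton,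
    finsum_mem_range hx, finsum_mem_range Coord.u_injective, finsum_eq_sum_of_fintype]
  · rw [Set.disjoint_left]
    rintro _ rfl ⟨j, hj⟩
    simp at hj
  · rw [Set.disjoint_left]
    rintro _ h ⟨c, rfl⟩
    simp at h

theorem finsum_prod_prod {α β γ M : Type*} [Fintype α] [Fintype β] [AddCommMonoid M]
    (φ : α × β × γ → M) (hφ : (Function.support φ).Finite) :
    ∑ᶠ c, φ c = ∑ a, ∑ b, ∑ᶠ c, φ (a, b, c) := by
  rw [finsum_curry _ hφ, finsum_eq_sum_of_fintype]
  refine Finset.sum_congr rfl fun a _ => ?_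
  rw [finsum_curry, finsum_eq_sum_of_fintype]
  exact (hφ.preimage (f := fun p : β × γ => (a, p)) (fun x _ y _ h => by simpa using h))

end CoordSums

/-- A ring of functions of the coordinates `C`, each depending on finitely many of them, with its
coordinate functions and partial derivatives. -/
structure Partials (C R : Type*) [CommRing R] [Algebra ℝ R] where
  /-- the partial derivatives -/
  d : C → Derivation ℝ R R
  /-- the coordinate functions -/
  coord : C → R
  comm : ∀ a b f, d a (d b f) = d b (d a f)
  finite : ∀ f, {c | d c f ≠ 0}.Finite
  d_coord_self : ∀ c, d c (coord c) = 1
  d_coord_of_ne : ∀ {c c'}, c ≠ c' → d c (coord c') = 0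

namespace Partials

section VectorField

variable {C R : Type*} [CommRing R] [Algebra ℝ R] (P : Partials C R)

/-- The differential of a function, as the finitely supported family of its partial derivatives. -/
def grad : Derivation ℝ R (C →₀ R) :=
  Derivation.mk'
    { toFun := fun f => Finsupp.ofSupportFinite (fun c => P.d c f) (P.finite f)
      map_add' := fun f g => Finsupp.ext fun c => map_add (P.d c) f g
      map_smul' := fun r f => Finsupp.ext fun c => (P.d c).map_smul r f }
    fun f g => Finsupp.ext fun c => (P.d c).leibniz f g

/-- The vector field `∑ a_c ∂_c`. -/
def vf (a : C → R) : Derivation ℝ R R :=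
  (Finsupp.linearCombination R a).compDer P.grad

theorem exists_finset (f : R) : ∃ T : Finset C, ∀ c ∉ T, P.d c f = 0 :=
  ⟨(P.grad f).support, fun _ hc => Finsupp.notMem_support_iff.1 hc⟩

theorem vf_eq_sum (a : C → R) {f : R} {T : Finset C} (hT : ∀ c ∉ T, P.d c f = 0) :
    P.vf a f = ∑ c ∈ T, a c * P.d c f := by
  refine (Finsupp.sum_of_support_subset (P.grad f) (fun c hc => ?_) _ (by simp)).trans
    (Finset.sum_congr rfl fun c _ => mul_comm _ _)
  exact by_contra fun h => Finsupp.mem_support_iff.1 hc (hT c h)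

theorem vf_eq_finsum (a : C → R) (f : R) : P.vf a f = ∑ᶠ c, a c * P.d c f := by
  obtain ⟨T, hT⟩ := P.exists_finset f
  rw [P.vf_eq_sum a hT, finsum_eq_sum_of_support_subset]
  exact fun c hc => by_contra fun h => hc (by simp only [hT c h, mul_zero])

theorem vf_add (a b : C → R) (f : R) : P.vf (a + b) f = P.vf a f + P.vf b f := by
  obtain ⟨T, hT⟩ := P.exists_finset f
  simp only [P.vf_eq_sum _ hT, Pi.add_apply, add_mul, Finset.sum_add_distrib]

theorem vf_eq_zero {a : C → R} (h : ∀ c, a c = 0) (f : R) : P.vf a f = 0 := by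
  rw [vf_eq_finsum]
  exact finsum_eq_zero_of_forall_eq_zero fun c => by rw [h, zero_mul]

theorem vf_eq_mul_d {a : C → R} {c : C} (h : ∀ e ≠ c, a e = 0) (f : R) :
    P.vf a f = a c * P.d c f := by
  rw [vf_eq_finsum]
  exact finsum_eq_single _ c fun e he => by rw [h e he, zero_mul]

@[simp]
theorem vf_coord (a : C → R) (c : C) : P.vf a (P.coord c) = a c := by
  rw [vf_eq_finsum, finsum_eq_single _ c fun e he => by rw [P.d_coord_of_ne he, mul_zero],
    P.d_coord_self, mul_one]

theorem derivation_vf (D : Derivation ℝ R R) (a : C → R) {f : R} {T : Finset C}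
    (hT : ∀ c ∉ T, P.d c f = 0) :
    D (P.vf a f) = ∑ c ∈ T, a c * D (P.d c f) + P.vf (fun c => D (a c)) f := by
  rw [P.vf_eq_sum a hT, P.vf_eq_sum _ hT, map_sum, ← Finset.sum_add_distrib]
  exact Finset.sum_congr rfl fun c _ => by
    rw [D.leibniz, smul_eq_mul, smul_eq_mul, mul_comm (D _)]

theorem d_vf (c : C) (a : C → R) (f : R) :
    P.d c (P.vf a f) = P.vf a (P.d c f) + P.vf (fun e => P.d c (a e)) f := by
  obtain ⟨T, hT⟩ := P.exists_finset f
  simp only [P.derivation_vf (P.d c) a hT, P.comm c]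
  rw [P.vf_eq_sum a fun e he => by rw [P.comm, hT e he, map_zero]]

theorem vf_comm {a b : C → R} (h : ∀ c, P.vf a (b c) = P.vf b (a c)) (f : R) :
    P.vf a (P.vf b f) = P.vf b (P.vf a f) := by
  obtain ⟨T, hT⟩ := P.exists_finset f
  have hTd : ∀ c, ∀ e ∉ T, P.d e (P.d c f) = 0 := fun c e he => by rw [P.comm, hT e he, map_zero]
  rw [P.derivation_vf _ b hT, P.derivation_vf _ a hT, funext h]
  simp only [P.vf_eq_sum a (hTd _), P.vf_eq_sum b (hTd _), Finset.mul_sum]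
  rw [Finset.sum_comm]
  simp only [P.comm, mul_left_comm (a _)]

end VectorField

section TotalDerivatives

variable {n m h : ℕ} {R : Type*} [CommRing R] [Algebra ℝ R] (P : Partials (Coord n m h) R)

/-- The coefficients of the total derivative with respect to `x_j`. -/
def dxCoeff (j : Fin n) : Coord n m h → R
  | .t => 0
  | .x j' => if j' = j then 1 else 0
  | .u s i I => P.coord (.u s i (I + Finsupp.single j 1))

/-- The total derivative with respect to `x_j`. -/
def dx (j : Fin n) : Derivation ℝ R R := P.vf (P.dxCoeff j)

theorem dx_comm (j k : Fin n) (f : R) : P.dx j (P.dx k f) = P.dx k (P.dx j f) := by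
  refine P.vf_comm (fun c => ?_) f
  cases c with
  | t => simp [dxCoeff]
  | x j' =>
    simp only [dxCoeff]
    split_ifs <;> simp
  | u s i I => simp [dxCoeff, add_right_comm]

/-- The iterated total derivative `D_x^I`. -/
abbrev dxI (I : Fin n →₀ ℕ) : Module.End ℝ R := DiffOp.iter P.dx I

/-- The coefficients of the total derivative with respect to `t` in virtue of the system
`∂_t^h u^i = F^i`. -/
def dtCoeff (F : Fin m → R) : Coord n m h → R
  | .t => 1
  | .x _ => 0
  | .u s i I => if hs : (s : ℕ) + 1 < h then P.coord (.u ⟨(s : ℕ) + 1, hs⟩ i I) else P.dxI I (F i)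

/-- The total derivative with respect to `t` in virtue of the system `∂_t^h u^i = F^i`. -/
def dt (F : Fin m → R) : Derivation ℝ R R := P.vf (P.dtCoeff F)

theorem dt_dx (F : Fin m → R) (j : Fin n) (f : R) :
    P.dt F (P.dx j f) = P.dx j (P.dt F f) := by
  refine P.vf_comm (fun c => ?_) f
  cases c with
  | t => simp [dxCoeff, dtCoeff]
  | x j' =>
    simp only [dxCoeff, dtCoeff]
    split_ifs <;> simp
  | u s i I =>
    simp only [dxCoeff, dtCoeff, vf_coord]
    split_ifs
    · rw [vf_coord, dxCoeff]
    · exact DiffOp.iter_add_single P.dx_comm I j (F i)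

/-- The linearization of a function with respect to the unknown `∂_t^s u^i`, as a differential
operator in the total derivatives `D_{x_j}`; it is zero for `s ≥ h`. -/
def lin (s : ℕ) (i : Fin m) : Derivation ℝ R (DiffOp n R) :=
  if hs : s < h then
    ((AddMonoidAlgebra.coeffLinearEquiv R).symm.toLinearMap ∘ₗ
      Finsupp.lcomapDomain (Coord.u ⟨s, hs⟩ i) fun I J hIJ => by simpa using hIJ).compDer P.grad
  else 0

theorem coeff_lin {s : ℕ} (hs : s < h) (i : Fin m) (I : Fin n →₀ ℕ) (f : R) :
    (P.lin s i f).coeff I = P.d (.u ⟨s, hs⟩ i I) f := by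
  rw [lin, dif_pos hs]
  rfl

theorem lin_mul (s : ℕ) (i : Fin m) (f g : R) :
    P.lin s i (f * g) = f • P.lin s i g + g • P.lin s i f :=
  (P.lin s i).leibniz f g

theorem lin_of_le {s : ℕ} (hs : h ≤ s) (i : Fin m) (f : R) : P.lin s i f = 0 := by
  rw [lin, dif_neg hs.not_gt, Derivation.zero_apply]

theorem lin_dx (s : ℕ) (i : Fin m) (j : Fin n) (f : R) :
    P.lin s i (P.dx j f) = DiffOp.deriv P.dx j (P.lin s i f) := by
  obtain hs | hs := lt_or_ge s h
  swap
  · simp only [P.lin_of_le hs, map_zero]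
  ext I
  by_cases hI : I j = 0
  · rw [DiffOp.coeff_deriv_of_eq_zero P.dx hI, P.coeff_lin hs, P.coeff_lin hs, dx, d_vf,
      add_eq_left]
    refine P.vf_eq_zero (fun c => ?_) _
    cases c with
    | t => simp [dxCoeff]
    | x j' =>
      simp only [dxCoeff]
      split_ifs <;> simp
    | u s' i' I' =>
      refine P.d_coord_of_ne fun h => ?_
      obtain ⟨-, -, rfl⟩ := Coord.u.inj h
      simp at hI
  · obtain ⟨I, rfl⟩ := exists_eq_add_single hI
    rw [DiffOp.coeff_add_single_deriv, P.coeff_lin hs, P.coeff_lin hs, P.coeff_lin hs, dx, d_vf,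
      add_comm, add_left_inj, P.vf_eq_mul_d (c := .u ⟨s, hs⟩ i I), dxCoeff, d_coord_self, one_mul]
    intro c hc
    cases c with
    | t => simp [dxCoeff]
    | x j' =>
      simp only [dxCoeff]
      split_ifs <;> simp
    | u s' i' I' =>
      refine P.d_coord_of_ne fun h => hc ?_
      simp only [Coord.u.injEq, add_left_inj] at h
      rw [h.1, h.2.1, h.2.2]

theorem lin_dxI (s : ℕ) (i : Fin m) (I : Fin n →₀ ℕ) (f : R) :
    P.lin s i (P.dxI I f) = DiffOp.iterDeriv P.dx I (P.lin s i f) := by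
  induction I using multiIndex_induction with
  | zero => simp
  | add_single I j ih =>
    rw [DiffOp.iter_add_single P.dx_comm, lin_dx, ih, DiffOp.iterDeriv_add_single P.dx_comm]

theorem vf_eq_sum_last [NeZero h] {a : Coord n m h → R} (ht : a .t = 0) (hx : ∀ j, a (.x j) = 0)
    (hu : ∀ (s : Fin h) k K, (s : ℕ) + 1 < h → a (.u s k K) = 0) (f : R) :
    P.vf a f = ∑ k, ∑ K ∈ (P.lin (h - 1) k f).support,
      (P.lin (h - 1) k f).coeff K * a (.u ⟨h - 1, Nat.sub_lt (NeZero.pos h) one_pos⟩ k K) := by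
  have hfin : (Function.support fun c => a c * P.d c f).Finite :=
    (P.finite f).subset fun c hc => right_ne_zero_of_mul hc
  rw [vf_eq_finsum, Coord.finsum_eq _ hfin,
    finsum_prod_prod _ (hfin.preimage Coord.u_injective.injOn)]
  simp only [ht, hx, zero_mul, Finset.sum_const_zero, zero_add]
  rw [Finset.sum_eq_single ⟨h - 1, Nat.sub_lt (NeZero.pos h) one_pos⟩]
  · refine Finset.sum_congr rfl fun k _ => ?_
    simp only [← P.coeff_lin (Nat.sub_lt (NeZero.pos h) one_pos), mul_comm (a _)]
    exact finsum_eq_sum_of_support_subset _ fun K hK =>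
      MvPolynomial.mem_support_iff.2 (left_ne_zero_of_mul hK)
  · intro s _ hs
    have hs' : (s : ℕ) ≠ h - 1 := Fin.val_ne_of_ne hs
    simp only [hu s _ _ (by omega), zero_mul, finsum_zero, Finset.sum_const_zero]
  · simp

theorem vf_eq_coeff_sum_comp [NeZero h] {a : Coord n m h → R} (ht : a .t = 0)
    (hx : ∀ j, a (.x j) = 0) (hu : ∀ (s : Fin h) k K, (s : ℕ) + 1 < h → a (.u s k K) = 0)
    (Q : Fin m → DiffOp n R) (I : Fin n →₀ ℕ)
    (ha : ∀ (s : Fin h) k K, (s : ℕ) + 1 = h →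
      a (.u s k K) = (DiffOp.iterDeriv P.dx K (Q k)).coeff I) (f : R) :
    P.vf a f = (∑ k, DiffOp.comp P.dx (Q k) (P.lin (h - 1) k f)).coeff I := by
  rw [P.vf_eq_sum_last ht hx hu, MvPolynomial.coeff_sum]
  refine Finset.sum_congr rfl fun k _ => ?_
  rw [DiffOp.coeff_comp]
  exact Finset.sum_congr rfl fun K _ => by rw [ha _ k K (Nat.sub_add_cancel NeZero.one_le)]

theorem lin_dt_zero [NeZero h] (i : Fin m) (F : Fin m → R) (f : R) :
    P.lin 0 i (P.dt F f) = DiffOp.mapCoeff (P.dt F : R →ₗ[ℝ] R) (P.lin 0 i f) +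
      ∑ k, DiffOp.comp P.dx (P.lin 0 i (F k)) (P.lin (h - 1) k f) := by
  ext I
  rw [MvPolynomial.coeff_add, DiffOp.coeff_mapCoeff, P.coeff_lin (NeZero.pos h),
    P.coeff_lin (NeZero.pos h), dt, d_vf]
  congr 1
  refine P.vf_eq_coeff_sum_comp ?_ ?_ ?_ _ _ ?_ f
  · simp [dtCoeff]
  · simp [dtCoeff]
  · intro s k K hs
    rw [dtCoeff, dif_pos hs]
    exact P.d_coord_of_ne fun h => by simp at h
  · intro s k K hs
    rw [dtCoeff, dif_neg hs.not_lt, ← P.coeff_lin, lin_dxI]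

theorem lin_dt_succ [NeZero h] {s : ℕ} (hs : s + 1 < h) (i : Fin m) (F : Fin m → R) (f : R) :
    P.lin (s + 1) i (P.dt F f) =
      DiffOp.mapCoeff (P.dt F : R →ₗ[ℝ] R) (P.lin (s + 1) i f) + P.lin s i f +
        ∑ k, DiffOp.comp P.dx (P.lin (s + 1) i (F k)) (P.lin (h - 1) k f) := by
  classical
  ext I
  let e : Coord n m h := .u ⟨s, by omega⟩ i I
  let a : Coord n m h → R := fun c => P.d (.u ⟨s + 1, hs⟩ i I) (P.dtCoeff F c)
  have ha : a = Pi.single e 1 + (a - Pi.single e 1) := (add_sub_cancel _ _).symm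
  rw [MvPolynomial.coeff_add, MvPolynomial.coeff_add, DiffOp.coeff_mapCoeff, P.coeff_lin hs,
    P.coeff_lin hs, P.coeff_lin (by omega), dt, d_vf, add_assoc]
  congr 1
  change P.vf a f = _
  rw [ha, vf_add, P.vf_eq_mul_d (c := e) fun c hc => Pi.single_eq_of_ne hc 1,
    Pi.single_eq_same, one_mul]
  congr 1
  refine P.vf_eq_coeff_sum_comp ?_ ?_ ?_ _ _ ?_ f
  · simp [a, e, dtCoeff]
  · simp [a, e, dtCoeff]
  · intro s' k K hs'
    simp only [a, Pi.sub_apply, dtCoeff, dif_pos hs', sub_eq_zero]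
    by_cases hc : Coord.u s' k K = e
    · obtain ⟨rfl, rfl, rfl⟩ := Coord.u.inj hc
      rw [hc, Pi.single_eq_same, d_coord_self]
    · rw [Pi.single_eq_of_ne hc, d_coord_of_ne]
      rintro ⟨⟩
      exact hc rfl
  · intro s' k K hs'
    have hne : (Coord.u s' k K : Coord n m h) ≠ e := fun h => by
      obtain ⟨rfl, -, -⟩ := Coord.u.inj h
      exact hs.ne hs'
    simp only [a, Pi.sub_apply, Pi.single_eq_of_ne hne, sub_zero, dtCoeff, dif_neg hs'.not_lt]
    rw [← P.coeff_lin, lin_dxI]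

end TotalDerivatives

end Partials

theorem derivation_pow_mul {k R : Type*} [CommRing k] [CommRing R] [Algebra k R]
    (D : Derivation k R R) (s : ℕ) (f g : R) :
    ((D : Module.End k R) ^ s) (f * g) = ∑ r ∈ Finset.range (s + 1),
      s.choose r • (((D : Module.End k R) ^ (s - r)) f * ((D : Module.End k R) ^ r) g) := by
  set T : Module.End k R := ↑D with hT
  rw [← Finset.Nat.sum_antidiagonal_eq_sum_range_succ
    fun r q => s.choose r • ((T ^ q) f * (T ^ r) g)]
  induction s with
  | zero => simp
  | succ s ih =>
    rw [Finset.sum_antidiagonal_choose_succ_nsmul fun r q => (T ^ q) f * (T ^ r) g, pow_succ',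
      Module.End.mul_apply, ih, map_sum, ← Finset.sum_add_distrib]
    refine Finset.sum_congr rfl fun p hp => ?_
    rw [map_nsmul, hT, Derivation.coeFn_coe, D.leibniz, ← s.choose_symm_of_eq_add
      (Finset.HasAntidiagonal.mem_antidiagonal.1 hp).symm]
    simp only [pow_succ', Module.End.mul_apply, Derivation.coeFn_coe, smul_eq_mul, smul_add]
    rw [add_comm, mul_comm (D _)]

namespace Partials

open MvPolynomial Matrix

variable {n m h : ℕ} {R : Type*} [CommRing R] [Algebra ℝ R] (P : Partials (Coord n m h) R)

section VariationalDerivative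

/-- The variational derivative `∑ (-1)^|I| D_x^I (∂f/∂u^i_{s,I})` of `f` with respect to
`∂_t^s u^i`. -/
def varDeriv (s : ℕ) (i : Fin m) : Module.End ℝ R :=
  LinearMap.applyₗ 1 ∘ₗ DiffOp.adjointEnd P.dx ∘ₗ (P.lin s i : R →ₗ[ℝ] DiffOp n R)

theorem varDeriv_apply (s : ℕ) (i : Fin m) (f : R) :
    P.varDeriv s i f = DiffOp.adjointEnd P.dx (P.lin s i f) 1 := rfl

theorem varDeriv_dx (s : ℕ) (i : Fin m) (j : Fin n) (f : R) :
    P.varDeriv s i (P.dx j f) = 0 := by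
  rw [varDeriv_apply, lin_dx, DiffOp.adjointEnd_deriv P.dx_comm, Derivation.map_one_eq_zero,
    map_zero, neg_zero]

variable [NeZero h]

theorem varDeriv_dt_zero (i : Fin m) (F : Fin m → R) (f : R) :
    P.varDeriv 0 i (P.dt F f) = P.dt F (P.varDeriv 0 i f) +
      ∑ k, DiffOp.adjointEnd P.dx (P.lin 0 i (F k)) (P.varDeriv (h - 1) k f) := by
  simp only [varDeriv_apply, lin_dt_zero, map_add, map_sum, LinearMap.add_apply,
    LinearMap.sum_apply, DiffOp.adjointEnd_comp P.dx_comm,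
    DiffOp.adjointEnd_mapCoeff_one P.dx_comm (P.dt_dx F)]

theorem varDeriv_dt_succ {s : ℕ} (hs : s + 1 < h) (i : Fin m) (F : Fin m → R) (f : R) :
    P.varDeriv (s + 1) i (P.dt F f) = P.dt F (P.varDeriv (s + 1) i f) + P.varDeriv s i f +
      ∑ k, DiffOp.adjointEnd P.dx (P.lin (s + 1) i (F k)) (P.varDeriv (h - 1) k f) := by
  simp only [varDeriv_apply, P.lin_dt_succ hs, map_add, map_sum, LinearMap.add_apply,
    LinearMap.sum_apply, DiffOp.adjointEnd_comp P.dx_comm,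
    DiffOp.adjointEnd_mapCoeff_one P.dx_comm (P.dt_dx F)]

variable {P} {F : Fin m → R} {f : R} (hf : ∀ s i, P.varDeriv s i (P.dt F f) = 0)

include hf

theorem neg_dt_pow_varDeriv {s : ℕ} (hs : s < h) (i : Fin m) :
    ((-(P.dt F : Module.End ℝ R)) ^ (s + 1)) (P.varDeriv s i f) =
      ∑ r ∈ Finset.range (s + 1), ((-(P.dt F : Module.End ℝ R)) ^ r)
        (∑ k, DiffOp.adjointEnd P.dx (P.lin r i (F k)) (P.varDeriv (h - 1) k f)) := by
  set T : Module.End ℝ R := -(P.dt F : Module.End ℝ R)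
  have hTapply : ∀ g, T g = -P.dt F g := fun g => rfl
  induction s with
  | zero =>
    have h0 := hf 0 i
    rw [varDeriv_dt_zero] at h0
    simpa [hTapply] using neg_eq_of_add_eq_zero_right h0
  | succ s ih =>
    have hsucc := hf (s + 1) i
    rw [P.varDeriv_dt_succ hs, add_assoc] at hsucc
    rw [Finset.sum_range_succ, ← ih (Nat.lt_of_succ_lt hs), ← map_add, pow_succ,
      Module.End.mul_apply, hTapply, neg_eq_of_add_eq_zero_right hsucc]

end VariationalDerivative

section Equation

variable (F : Fin m → R)

/-- The coefficient of `D_t^r` in `∑_{0<s<h} (-1)^s D_t^s ∘ ∂F^k/∂u^i_{s,0}`. -/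
def timeCoeff (i k : Fin m) (r : ℕ) : R :=
  ∑ s ∈ Finset.Ico 1 h, ((-1) ^ s * (s.choose r : ℝ)) •
    ((P.dt F : Module.End ℝ R) ^ (s - r)) ((P.lin s i (F k)).coeff 0)

/-- The part `∑_K f_K D_x^K` of the operator `[L]_{ik}`. -/
def spaceOp (i k : Fin m) : DiffOp n R :=
  DiffOp.adjoint P.dx (P.lin 0 i (F k)) + C (P.timeCoeff F i k 0)

variable {P F}

theorem sum_neg_dt_pow_mul (i k : Fin m) (g : R) :
    ∑ s ∈ Finset.Ico 1 h, ((-(P.dt F : Module.End ℝ R)) ^ s) ((P.lin s i (F k)).coeff 0 * g) =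
      ∑ r ∈ Finset.range h, P.timeCoeff F i k r * ((P.dt F : Module.End ℝ R) ^ r) g := by
  simp only [timeCoeff, Finset.sum_mul]
  rw [Finset.sum_comm]
  refine Finset.sum_congr rfl fun s hs => ?_
  rw [← neg_one_smul ℝ, smul_pow, LinearMap.smul_apply, derivation_pow_mul,
    Finset.sum_subset (Finset.range_subset_range.2 (Finset.mem_Ico.1 hs).2), Finset.smul_sum]
  · refine Finset.sum_congr rfl fun r _ => ?_
    rw [smul_mul_assoc, mul_smul, Nat.cast_smul_eq_nsmul]
  · intro r _ hr
    rw [Nat.choose_eq_zero_of_lt (by simpa using hr), zero_smul]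

variable [NeZero h]

/-- The adjoint linearized equation `(-D_t)^h χ = L χ` for the characteristic of a conservation
law. -/
theorem neg_dt_pow_varDeriv_last (hF : ∀ s i k, s ≠ 0 → (P.lin s i (F k)).totalDegree = 0) {f : R}
    (hf : ∀ s i, P.varDeriv s i (P.dt F f) = 0) (i : Fin m) :
    ((-(P.dt F : Module.End ℝ R)) ^ h) (P.varDeriv (h - 1) i f) =
      ∑ k, (DiffOp.toEnd P.dx (P.spaceOp F i k) (P.varDeriv (h - 1) k f) +
        ∑ r ∈ Finset.Ico 1 h, P.timeCoeff F i k r *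
          ((P.dt F : Module.End ℝ R) ^ r) (P.varDeriv (h - 1) k f)) := by
  have hlast : h - 1 + 1 = h := Nat.sub_add_cancel NeZero.one_le
  have hsum := neg_dt_pow_varDeriv hf (Nat.sub_lt (NeZero.pos h) one_pos) i
  rw [hlast, Finset.range_eq_Ico, Finset.sum_eq_sum_Ico_succ_bot (NeZero.pos h)] at hsum
  rw [hsum]
  simp only [map_sum]
  rw [Finset.sum_comm, ← Finset.sum_add_distrib]
  refine Finset.sum_congr rfl fun k _ => ?_
  have hC : ∀ s ∈ Finset.Ico 1 h,
      DiffOp.adjointEnd P.dx (P.lin s i (F k)) (P.varDeriv (h - 1) k f) =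
        (P.lin s i (F k)).coeff 0 * P.varDeriv (h - 1) k f := fun s hs => by
    rw [← DiffOp.adjointEnd_C P.dx, ← totalDegree_eq_zero_iff_eq_C.1
      (hF s i k (Nat.one_le_iff_ne_zero.1 (Finset.mem_Ico.1 hs).1))]
  rw [zero_add, Finset.sum_congr rfl fun s hs => by rw [hC s hs], sum_neg_dt_pow_mul,
    Finset.range_eq_Ico, Finset.sum_eq_sum_Ico_succ_bot (NeZero.pos h), spaceOp, map_add,
    LinearMap.add_apply, DiffOp.toEnd_adjoint P.dx_comm, DiffOp.toEnd_C, pow_zero, pow_zero,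
    Module.End.one_apply, Module.End.one_apply, add_assoc]

end Equation

section Degrees

variable {P} [NeZero h] {F : Fin m → R} {M N r c : ℕ} {g : R}

/-- Bounds for the degrees of the linearizations of a function of order at most `M + N` that is
obtained, by applying `D_t` `r` times, from a function of order at most `M` whose derivatives of
top order `M` involve at most `c - r` differentiations in `t`. -/
structure DegreeBounds (P : Partials (Coord n m h) R) (M N r c : ℕ) (g : R) : Prop where
  totalDegree_le : ∀ s i, (P.lin s i g).totalDegree ≤ M + N
  totalDegree_le_of_le : ∀ {s}, r ≤ s → ∀ i, (P.lin s i g).totalDegree ≤ M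
  top_eq_zero : ∀ {s}, r ≤ s → c < s → ∀ i, homogeneousComponent M (P.lin s i g) = 0
  top_add_eq_zero : ∀ {s}, c < s + h → ∀ i, homogeneousComponent (M + N) (P.lin s i g) = 0

omit [NeZero h] in
theorem homogeneousComponent_mapCoeff_eq_zero {T : R →ₗ[ℝ] R} {b : ℕ} {Q : DiffOp n R}
    (hQ : homogeneousComponent b Q = 0) : homogeneousComponent b (DiffOp.mapCoeff T Q) = 0 := by
  rw [DiffOp.homogeneousComponent_mapCoeff, hQ, map_zero]

section SpacePart

variable (hFN : ∀ i k, (P.lin 0 i (F k)).totalDegree ≤ N)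
  (hg : ∀ k, (P.lin (h - 1) k g).totalDegree ≤ M)

include hFN hg

theorem totalDegree_lin_dt_zero_le {i : Fin m} (h0 : (P.lin 0 i g).totalDegree ≤ M + N) :
    (P.lin 0 i (P.dt F g)).totalDegree ≤ M + N := by
  rw [lin_dt_zero]
  refine (totalDegree_add _ _).trans (max_le ((DiffOp.totalDegree_mapCoeff_le _ _).trans h0) ?_)
  exact totalDegree_finsetSum_le fun k _ => (DiffOp.totalDegree_comp_le P.dx_comm _ _).trans
    (add_le_add (hg k) (hFN i k))

theorem homogeneousComponent_lin_dt_zero {i : Fin m}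
    (h0 : homogeneousComponent (M + N) (P.lin 0 i g) = 0) :
    homogeneousComponent (M + N) (P.lin 0 i (P.dt F g)) =
      ∑ k, homogeneousComponent M (P.lin (h - 1) k g) *
        homogeneousComponent N (P.lin 0 i (F k)) := by
  simp only [lin_dt_zero, map_add, map_sum, homogeneousComponent_mapCoeff_eq_zero h0, zero_add,
    DiffOp.homogeneousComponent_comp P.dx_comm (hg _) (hFN i _)]

end SpacePart

section TimePart

variable (hFT : ∀ s i k, s ≠ 0 → (P.lin s i (F k)).totalDegree = 0) {b s : ℕ} (hs : s + 1 < h)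
  (hg : ∀ k, (P.lin (h - 1) k g).totalDegree ≤ b) {i : Fin m}

include hFT hs hg

theorem totalDegree_lin_dt_succ_le (h1 : (P.lin (s + 1) i g).totalDegree ≤ b)
    (h0 : (P.lin s i g).totalDegree ≤ b) : (P.lin (s + 1) i (P.dt F g)).totalDegree ≤ b := by
  rw [P.lin_dt_succ hs]
  refine (totalDegree_add _ _).trans (max_le ((totalDegree_add _ _).trans (max_le
    ((DiffOp.totalDegree_mapCoeff_le _ _).trans h1) h0)) ?_)
  exact totalDegree_finsetSum_le fun k _ => (DiffOp.totalDegree_comp_le P.dx_comm _ _).trans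
    (by rw [hFT _ _ _ s.succ_ne_zero, add_zero]; exact hg k)

theorem homogeneousComponent_lin_dt_succ
    (hgb : ∀ k, homogeneousComponent b (P.lin (h - 1) k g) = 0)
    (h1 : homogeneousComponent b (P.lin (s + 1) i g) = 0) :
    homogeneousComponent b (P.lin (s + 1) i (P.dt F g)) =
      homogeneousComponent b (P.lin s i g) := by
  have hcomp : ∀ k, homogeneousComponent b
      (DiffOp.comp P.dx (P.lin (s + 1) i (F k)) (P.lin (h - 1) k g)) = 0 := fun k => by
    rw [← add_zero b, DiffOp.homogeneousComponent_comp P.dx_comm (hg k)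
      (hFT (s + 1) i k s.succ_ne_zero).le, hgb, zero_mul]
  simp only [P.lin_dt_succ hs, map_add, map_sum, homogeneousComponent_mapCoeff_eq_zero h1, zero_add,
    hcomp, Finset.sum_const_zero, add_zero]

end TimePart

namespace DegreeBounds

omit [NeZero h] in
theorem of_top_eq_zero (hN : 0 < N) (hg : ∀ s i, (P.lin s i g).totalDegree ≤ M)
    (htop : ∀ s i, c < s → homogeneousComponent M (P.lin s i g) = 0) :
    DegreeBounds P M N 0 c g where
  totalDegree_le s i := (hg s i).trans (Nat.le_add_right M N)
  totalDegree_le_of_le _ i := hg _ i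
  top_eq_zero _ hs i := htop _ i hs
  top_add_eq_zero _ i := homogeneousComponent_eq_zero _ _ ((hg _ i).trans_lt (by omega))

omit [NeZero h] in
theorem totalDegree_last_le (hg : DegreeBounds P M N r c g) (hr : r < h) (k : Fin m) :
    (P.lin (h - 1) k g).totalDegree ≤ M :=
  hg.totalDegree_le_of_le (by omega) k

variable (hFN : ∀ i k, (P.lin 0 i (F k)).totalDegree ≤ N)
  (hFT : ∀ s i k, s ≠ 0 → (P.lin s i (F k)).totalDegree = 0)

include hFT

theorem top_dt_succ (hg : DegreeBounds P M N r c g) (hr : r ≤ c) (hc : c + 1 < h) (i : Fin m) :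
    homogeneousComponent M (P.lin (c + 1) i (P.dt F g)) = homogeneousComponent M (P.lin c i g) :=
  homogeneousComponent_lin_dt_succ hFT hc (hg.totalDegree_last_le (by omega))
    (hg.top_eq_zero (by omega) (by omega)) (hg.top_eq_zero (by omega) (by omega) i)

theorem top_add_dt_succ (hg : DegreeBounds P M N r c g) (hN : 0 < N) (hr : r < h) {s : ℕ}
    (hs : s + 1 < h) (hc : c < s + 1 + h) (i : Fin m) :
    homogeneousComponent (M + N) (P.lin (s + 1) i (P.dt F g)) =
      homogeneousComponent (M + N) (P.lin s i g) := by
  have hlast := hg.totalDegree_last_le hr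
  exact homogeneousComponent_lin_dt_succ hFT hs (fun k => (hlast k).trans (Nat.le_add_right M N))
    (fun k => homogeneousComponent_eq_zero _ _ ((hlast k).trans_lt (by omega)))
    (hg.top_add_eq_zero hc i)

include hFN

theorem dt (hg : DegreeBounds P M N r c g) (hN : 0 < N) (hr : r < h) :
    DegreeBounds P M N (r + 1) (c + 1) (P.dt F g) := by
  have hlast := hg.totalDegree_last_le hr
  refine ⟨fun s i => ?_, fun {s} hs i => ?_, fun {s} hrs hcs i => ?_, fun {s} hs i => ?_⟩ <;>
    obtain hsh | hsh := le_or_gt h s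
  · simp [P.lin_of_le hsh]
  · cases s with
    | zero => exact totalDegree_lin_dt_zero_le hFN hlast (hg.totalDegree_le 0 i)
    | succ s =>
      exact totalDegree_lin_dt_succ_le hFT hsh (fun k => (hlast k).trans (Nat.le_add_right M N))
        (hg.totalDegree_le _ i) (hg.totalDegree_le _ i)
  · simp [P.lin_of_le hsh]
  · cases s with
    | zero => omega
    | succ s =>
      exact totalDegree_lin_dt_succ_le hFT hsh hlast (hg.totalDegree_le_of_le (by omega) i)
        (hg.totalDegree_le_of_le (by omega) i)
  · simp [P.lin_of_le hsh]
  · cases s with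
    | zero => omega
    | succ s =>
      rw [homogeneousComponent_lin_dt_succ hFT hsh hlast (hg.top_eq_zero (by omega) (by omega))
        (hg.top_eq_zero (by omega) (by omega) i), hg.top_eq_zero (by omega) (by omega)]
  · simp [P.lin_of_le hsh]
  · cases s with
    | zero =>
      rw [homogeneousComponent_lin_dt_zero hFN hlast (hg.top_add_eq_zero (by omega) i)]
      simp only [hg.top_eq_zero (show r ≤ h - 1 by omega) (show c < h - 1 by omega), zero_mul,
        Finset.sum_const_zero]
    | succ s =>
      rw [hg.top_add_dt_succ hFT hN hr hsh (by omega), hg.top_add_eq_zero (by omega)]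

theorem dt_pow (hg : DegreeBounds P M N 0 c g) (hN : 0 < N) (hr : r ≤ h) :
    DegreeBounds P M N r (c + r) (((P.dt F : Module.End ℝ R) ^ r) g) := by
  induction r with
  | zero => exact hg
  | succ r ih =>
    rw [pow_succ', Module.End.mul_apply]
    exact (ih (by omega)).dt hFN hFT hN hr

theorem top_dt_pow (hg : DegreeBounds P M N 0 c g) (hN : 0 < N) (hr : c + r < h) (i : Fin m) :
    homogeneousComponent M (P.lin (c + r) i (((P.dt F : Module.End ℝ R) ^ r) g)) =
      homogeneousComponent M (P.lin c i g) := by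
  induction r with
  | zero => rfl
  | succ r ih =>
    rw [pow_succ', Module.End.mul_apply, ← ih (by omega)]
    exact (hg.dt_pow hFN hFT hN (by omega)).top_dt_succ hFT (by omega) hr i

theorem top_add_dt_pow (hg : DegreeBounds P M N 0 c g) (hN : 0 < N) {s : ℕ} (hs : s ≤ c)
    (hc : c < h) (i : Fin m) :
    homogeneousComponent (M + N)
        (P.lin s i (((P.dt F : Module.End ℝ R) ^ (h - c + s)) g)) =
      ∑ k, homogeneousComponent M (P.lin c k g) * homogeneousComponent N (P.lin 0 i (F k)) := by
  induction s with
  | zero =>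
    obtain ⟨r, rfl⟩ : ∃ r, h = c + r + 1 := ⟨h - c - 1, by omega⟩
    have hr := hg.dt_pow hFN hFT hN (r := r) (by omega)
    rw [show c + r + 1 - c + 0 = r + 1 by omega, pow_succ', Module.End.mul_apply]
    refine (homogeneousComponent_lin_dt_zero hFN (hr.totalDegree_last_le (by omega))
      (hr.top_add_eq_zero (by omega) i)).trans (Finset.sum_congr rfl fun k _ => ?_)
    rw [Nat.add_sub_cancel, hg.top_dt_pow hFN hFT hN (by omega)]
  | succ s ih =>
    rw [← ih (by omega), ← add_assoc, pow_succ', Module.End.mul_apply]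
    exact (hg.dt_pow hFN hFT hN (by omega)).top_add_dt_succ hFT hN (by omega) (by omega)
      (by omega) i

end DegreeBounds

end Degrees

section Symbol

/-- The matrix with entries `∑_{|I| = a} (∂f_i/∂u^j_{s,I}) q^I`. -/
def symbolAt {ι : Type*} (a s : ℕ) (f : ι → R) : Matrix ι (Fin m) (DiffOp n R) :=
  .of fun i j => homogeneousComponent a (P.lin s j (f i))

variable {P} {F : Fin m → R} {M N : ℕ}

theorem lin_toEnd (Q : DiffOp n R) (g : R) (s : ℕ) (i : Fin m) :
    P.lin s i (DiffOp.toEnd P.dx Q g) = DiffOp.comp P.dx (P.lin s i g) Q +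
      ∑ I ∈ Q.support, P.dxI I g • P.lin s i (Q.coeff I) := by
  rw [DiffOp.toEnd, DiffOp.comp, DiffOp.lift_apply, DiffOp.lift_apply, LinearMap.sum_apply,
    map_sum, ← Finset.sum_add_distrib]
  refine Finset.sum_congr rfl fun I _ => ?_
  rw [LinearMap.compl₂_apply, LinearMap.mul_apply', lin_mul, lin_dxI]
  rfl

theorem homogeneousComponent_lin_toEnd {Q : DiffOp n R} {g : R} {s : ℕ} {i : Fin m}
    (hQ : Q.totalDegree ≤ N) (hQc : ∀ I, (P.lin s i (Q.coeff I)).totalDegree < M + N)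
    (hg : (P.lin s i g).totalDegree ≤ M) :
    homogeneousComponent (M + N) (P.lin s i (DiffOp.toEnd P.dx Q g)) =
      homogeneousComponent N Q * homogeneousComponent M (P.lin s i g) := by
  rw [lin_toEnd, map_add, add_comm M, DiffOp.homogeneousComponent_comp P.dx_comm hQ hg, map_sum,
    add_eq_left]
  refine Finset.sum_eq_zero fun I _ => ?_
  rw [map_smul, homogeneousComponent_eq_zero _ _ (add_comm M N ▸ hQc I), smul_zero]

theorem totalDegree_spaceOp_le {i k : Fin m} (hF : (P.lin 0 i (F k)).totalDegree ≤ N) :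
    (P.spaceOp F i k).totalDegree ≤ N :=
  (totalDegree_add _ _).trans <| max_le ((DiffOp.totalDegree_adjoint_le P.dx_comm _).trans hF) <| by
    rw [totalDegree_C]
    exact Nat.zero_le N

theorem homogeneousComponent_spaceOp {i k : Fin m} (hF : (P.lin 0 i (F k)).totalDegree ≤ N)
    (hN : 0 < N) : homogeneousComponent N (P.spaceOp F i k) =
      (-1 : ℝ) ^ N • homogeneousComponent N (P.lin 0 i (F k)) := by
  rw [spaceOp, map_add, DiffOp.homogeneousComponent_adjoint P.dx_comm hF,
    homogeneousComponent_eq_zero _ (C _) (by rwa [totalDegree_C]), add_zero]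

/-- The terms of top order `M + N` of the linearization of the adjoint linearized equation with
respect to `∂_t^c u^j`. -/
theorem neg_one_pow_smul_symbolAt_mul [NeZero h] {c : ℕ} (hc : c < h) (hN : 0 < N)
    (hFN : ∀ i k, (P.lin 0 i (F k)).totalDegree ≤ N)
    (hFT : ∀ s i k, s ≠ 0 → (P.lin s i (F k)).totalDegree = 0) {f : R}
    (hf : ∀ s i, P.varDeriv s i (P.dt F f) = 0)
    (hχ : ∀ i, DegreeBounds P M N 0 c (P.varDeriv (h - 1) i f))
    (hX : ∀ i k K s j, (P.lin s j ((P.spaceOp F i k).coeff K)).totalDegree < M + N)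
    (hT : ∀ i k, ∀ r ∈ Finset.Ico 1 h, ∀ s j,
      (P.lin s j (P.timeCoeff F i k r)).totalDegree < M + N) :
    (-1 : ℝ) ^ h •
        (P.symbolAt M c (fun i => P.varDeriv (h - 1) i f) * P.symbolAt N 0 F) =
      (-1 : ℝ) ^ N •
        ((P.symbolAt N 0 F)ᵀ * P.symbolAt M c (fun i => P.varDeriv (h - 1) i f)) := by
  ext1 i j
  have hspace : ∀ k, homogeneousComponent (M + N) (P.lin c j
      (DiffOp.toEnd P.dx (P.spaceOp F i k) (P.varDeriv (h - 1) k f))) =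
        (-1 : ℝ) ^ N • (homogeneousComponent N (P.lin 0 i (F k)) *
          homogeneousComponent M (P.lin c j (P.varDeriv (h - 1) k f))) := fun k => by
    rw [homogeneousComponent_lin_toEnd (totalDegree_spaceOp_le (hFN i k)) (fun K => hX i k K c j)
      ((hχ k).totalDegree_le_of_le c.zero_le j), homogeneousComponent_spaceOp (hFN i k) hN,
      smul_mul_assoc]
  have htime : ∀ k, ∀ r ∈ Finset.Ico 1 h, homogeneousComponent (M + N) (P.lin c j
      (P.timeCoeff F i k r * ((P.dt F : Module.End ℝ R) ^ r) (P.varDeriv (h - 1) k f))) = 0 :=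
    fun k r hr => by
      have hrh := (Finset.mem_Ico.1 hr).2
      rw [lin_mul, map_add, map_smul, map_smul, homogeneousComponent_eq_zero _ _ (hT i k r hr c j),
        ((hχ k).dt_pow hFN hFT hN hrh.le).top_add_eq_zero (by omega), smul_zero, smul_zero,
        add_zero]
  have htop := (hχ i).top_add_dt_pow hFN hFT hN le_rfl hc j
  rw [Nat.sub_add_cancel hc.le] at htop
  have hadj := congrArg (fun g => homogeneousComponent (M + N) (P.lin c j g))
    (neg_dt_pow_varDeriv_last hFT hf i)
  simp only [map_sum, map_add, hspace] at hadj
  rw [← neg_one_smul ℝ, smul_pow, LinearMap.smul_apply, Derivation.map_smul,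
    LinearMap.map_smul_of_tower, htop] at hadj
  simp only [symbolAt, Matrix.smul_apply, Matrix.mul_apply, Matrix.transpose_apply,
    Matrix.of_apply]
  rw [hadj, Finset.smul_sum]
  refine Finset.sum_congr rfl fun k _ => ?_
  rw [Finset.sum_eq_zero (htime k), add_zero]

end Symbol

end Partials

open Classical in
theorem isOpenMap_finset_restrict {ι : Type*} {X : ι → Type*} [∀ i, TopologicalSpace (X i)]
    (T : Finset ι) : IsOpenMap (T.restrict (π := X)) := by
  refine IsOpenMap.of_sections fun p => ⟨Function.updateFinset p T, ?_, ?_, fun y => ?_⟩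
  · refine Continuous.continuousAt (continuous_pi fun c => ?_)
    by_cases hc : c ∈ T
    · simpa only [Function.updateFinset, hc, dif_pos] using continuous_apply (⟨c, hc⟩ : T)
    · simpa only [Function.updateFinset, hc, dif_neg, not_false_iff] using continuous_const
  · exact Function.updateFinset_restrict p
  · exact Function.restrict_updateFinset p y

section Calculus

variable {n m h : ℕ} {U : Set (Jet n m h)} {T : Finset (Coord n m h)} {g g' : (T → ℝ) → ℝ}
  {a a' : U → ℝ}

/-- The projection of the jet space to the coordinates in `T`. -/
abbrev proj (T : Finset (Coord n m h)) : Jet n m h → T → ℝ :=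
  T.restrict (π := fun _ => ℝ)

/-- The image in `T → ℝ` of the direction of the coordinate `c`; it vanishes if `c ∉ T`. -/
def dir (T : Finset (Coord n m h)) (c : Coord n m h) : T → ℝ :=
  open Classical in proj T (Pi.single c 1)

theorem dir_eq_zero {c : Coord n m h} (hc : c ∉ T) : dir T c = 0 := by
  classical
  ext ⟨c', hc'⟩
  exact Pi.single_eq_of_ne (ne_of_mem_of_not_mem hc' hc) _

/-- The function `a` on `U` is the smooth function `g` of the coordinates in `T`. -/
def Represents (U : Set (Jet n m h)) (T : Finset (Coord n m h)) (g : (T → ℝ) → ℝ)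
    (a : U → ℝ) : Prop :=
  ContDiffOn ℝ ∞ g (proj T '' U) ∧ ∀ p : U, a p = g (proj T p)

namespace Represents

theorem const (T : Finset (Coord n m h)) (r : ℝ) : Represents U T (fun _ => r) fun _ => r :=
  ⟨contDiffOn_const, fun _ => rfl⟩

theorem coord {c : Coord n m h} (hc : c ∈ T) :
    Represents U T (fun y => y ⟨c, hc⟩) fun p => (p : Jet n m h) c :=
  ⟨(contDiff_apply _ _ _).contDiffOn, fun _ => rfl⟩

theorem add (ha : Represents U T g a) (ha' : Represents U T g' a') :
    Represents U T (fun y => g y + g' y) (a + a') :=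
  ⟨ha.1.add ha'.1, fun p => congrArg₂ (· + ·) (ha.2 p) (ha'.2 p)⟩

theorem mul (ha : Represents U T g a) (ha' : Represents U T g' a') :
    Represents U T (fun y => g y * g' y) (a * a') :=
  ⟨ha.1.mul ha'.1, fun p => congrArg₂ (· * ·) (ha.2 p) (ha'.2 p)⟩

theorem exists_of_subset (ha : Represents U T g a) {T' : Finset (Coord n m h)} (hT : T ⊆ T') :
    ∃ g', Represents U T' g' a := by
  refine ⟨fun y => g fun c => y ⟨c, hT c.2⟩, ha.1.comp (t := proj T '' U) ?_ ?_, ha.2⟩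
  · exact (contDiff_pi.2 fun c => contDiff_apply _ _ _).contDiffOn
  · rintro _ ⟨p, hp, rfl⟩
    exact ⟨p, hp, rfl⟩

theorem contDiffAt (hU : IsOpen U) (ha : Represents U T g a) (p : U) :
    ContDiffAt ℝ ∞ g (proj T p) :=
  ha.1.contDiffAt ((isOpenMap_finset_restrict T U hU).mem_nhds ⟨p, p.2, rfl⟩)

theorem differentiableAt (hU : IsOpen U) (ha : Represents U T g a) (p : U) :
    DifferentiableAt ℝ g (proj T p) :=
  (ha.contDiffAt hU p).differentiableAt (by simp)

theorem pd_apply (hU : IsOpen U) (ha : Represents U T g a) {f : JetFun n m h}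
    (hf : ∀ p : U, f p = a p) (p : U) (c : Coord n m h) :
    pd c f p = fderiv ℝ g (proj T p) (dir T c) := by
  classical
  have hline : HasDerivAt (fun r : ℝ => proj T (Function.update (p : Jet n m h) c r))
      (dir T c) ((p : Jet n m h) c) := by
    refine hasDerivAt_pi.2 fun c' => ?_
    by_cases hc : (c' : Coord n m h) = c
    · simpa [dir, hc] using hasDerivAt_id' _
    · simpa [dir, hc] using hasDerivAt_const _ _
  have hmem : ∀ᶠ r in nhds ((p : Jet n m h) c), Function.update (p : Jet n m h) c r ∈ U := by
    refine (continuous_const.update c continuous_id).continuousAt.eventually_mem (hU.mem_nhds ?_)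
    rw [id, Function.update_eq_self]
    exact p.2
  have hg : DifferentiableAt ℝ g
      (proj T (Function.update (p : Jet n m h) c ((p : Jet n m h) c))) := by
    rw [Function.update_eq_self]
    exact ha.differentiableAt hU p
  refine (((hg.hasFDerivAt.comp_hasDerivAt _ hline).congr_of_eventuallyEq ?_).deriv).trans ?_
  · filter_upwards [hmem] with r hr
    exact (hf ⟨_, hr⟩).trans (ha.2 ⟨_, hr⟩)
  · rw [Function.update_eq_self]

theorem fderiv_dir (hU : IsOpen U) (ha : Represents U T g a) {f : JetFun n m h}
    (hf : ∀ p : U, f p = a p) (c : Coord n m h) :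
    Represents U T (fun y => fderiv ℝ g y (dir T c)) fun p => pd c f p :=
  ⟨(ha.1.fderiv_of_isOpen (isOpenMap_finset_restrict T U hU) (by simp)).clm_apply
    contDiffOn_const, fun p => ha.pd_apply hU hf p c⟩

end Represents

theorem exists_represents₂ (ha : ∃ T g, Represents U T g a) (ha' : ∃ T g, Represents U T g a') :
    ∃ T g g', Represents U T g a ∧ Represents U T g' a' := by
  classical
  obtain ⟨T, g, hg⟩ := ha
  obtain ⟨T', g', hg'⟩ := ha'
  obtain ⟨k, hk⟩ := hg.exists_of_subset (Finset.subset_union_left (s₂ := T'))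
  obtain ⟨k', hk'⟩ := hg'.exists_of_subset (Finset.subset_union_right (s₁ := T))
  exact ⟨_, k, k', hk, hk'⟩

end Calculus

section SmoothAlgebra

variable {n m h : ℕ} {U : Set (Jet n m h)}

/-- The algebra of smooth functions of finitely many coordinates on `U`. -/
def smoothAlgebra (U : Set (Jet n m h)) : Subalgebra ℝ (U → ℝ) where
  carrier := {a | ∃ T g, Represents U T g a}
  mul_mem' ha ha' := by
    obtain ⟨T, g, g', hg, hg'⟩ := exists_represents₂ ha ha'
    exact ⟨T, _, hg.mul hg'⟩
  add_mem' ha ha' := by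
    obtain ⟨T, g, g', hg, hg'⟩ := exists_represents₂ ha ha'
    exact ⟨T, _, hg.add hg'⟩
  algebraMap_mem' r := ⟨∅, _, Represents.const ∅ r⟩

/-- The function `f` restricts to the element `a` of the ring of smooth functions on `U`. -/
def Rep (f : JetFun n m h) (a : smoothAlgebra U) : Prop :=
  ∀ p : U, f p = (a : U → ℝ) p

theorem IsSmoothIn.exists_represents {V : Set (Coord n m h)} {f : JetFun n m h}
    (hf : IsSmoothIn V U f) :
    ∃ T : Finset (Coord n m h), ↑T ⊆ V ∧ ∃ g, Represents U T g fun p => f p := by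
  obtain ⟨T, hT, g, hg, hfg⟩ := hf
  exact ⟨T, hT, g, hg, fun p => hfg p p.2⟩

theorem IsSmoothIn.exists_rep {V : Set (Coord n m h)} {f : JetFun n m h} (hf : IsSmoothIn V U f) :
    ∃ a : smoothAlgebra U, Rep f a := by
  obtain ⟨T, -, g, hg⟩ := hf.exists_represents
  exact ⟨⟨fun p => f p, T, g, hg⟩, fun _ => rfl⟩

variable (hU : IsOpen U)

theorem rep_extend (a : smoothAlgebra U) : Rep (Function.extend Subtype.val (a : U → ℝ) 0) a :=
  fun p => Subtype.val_injective.extend_apply _ _ p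

/-- The partial derivative on the ring of smooth functions on `U`. As `pd` acts on functions on
the whole jet space, it is applied to the extension by zero. -/
def pdRing (c : Coord n m h) (a : smoothAlgebra U) : smoothAlgebra U :=
  ⟨fun p => pd c (Function.extend Subtype.val (a : U → ℝ) 0) p,
    let ⟨T, _, hg⟩ := a.2
    ⟨T, _, hg.fderiv_dir hU (rep_extend a) c⟩⟩

theorem Represents.pdRing {T : Finset (Coord n m h)} {g : (T → ℝ) → ℝ} {a : smoothAlgebra U}
    (ha : Represents U T g a) (c : Coord n m h) :
    Represents U T (fun y => fderiv ℝ g y (dir T c)) (pdRing hU c a) :=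
  ha.fderiv_dir hU (rep_extend a) c

theorem Represents.pdRing_apply {T : Finset (Coord n m h)} {g : (T → ℝ) → ℝ} {a : smoothAlgebra U}
    (ha : Represents U T g a) (c : Coord n m h) (p : U) :
    (GenEvol.pdRing hU c a : U → ℝ) p = fderiv ℝ g (proj T p) (dir T c) :=
  (ha.pdRing hU c).2 p

theorem Rep.pdRing {f : JetFun n m h} {a : smoothAlgebra U} (hf : Rep f a) (c : Coord n m h) :
    Rep (pd c f) (pdRing hU c a) := fun p => by
  obtain ⟨T, g, hg⟩ := a.2
  rw [hg.pd_apply hU hf, hg.pdRing_apply]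

theorem pdRing_add (c : Coord n m h) (a b : smoothAlgebra U) :
    pdRing hU c (a + b) = pdRing hU c a + pdRing hU c b := by
  obtain ⟨T, g, g', hg, hg'⟩ := exists_represents₂ a.2 b.2
  ext p
  refine (Represents.pdRing_apply hU (a := a + b) (hg.add hg') c p).trans ?_
  rw [fderiv_fun_add (hg.differentiableAt hU p) (hg'.differentiableAt hU p)]
  exact (((hg.pdRing hU c).add (hg'.pdRing hU c)).2 p).symm

theorem pdRing_mul (c : Coord n m h) (a b : smoothAlgebra U) :
    pdRing hU c (a * b) = a * pdRing hU c b + b * pdRing hU c a := by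
  obtain ⟨T, g, g', hg, hg'⟩ := exists_represents₂ a.2 b.2
  ext p
  refine (Represents.pdRing_apply hU (a := a * b) (hg.mul hg') c p).trans ?_
  rw [fderiv_fun_mul (hg.differentiableAt hU p) (hg'.differentiableAt hU p)]
  exact (((hg.mul (hg'.pdRing hU c)).add (hg'.mul (hg.pdRing hU c))).2 p).symm

theorem pdRing_smul (c : Coord n m h) (r : ℝ) (a : smoothAlgebra U) :
    pdRing hU c (r • a) = r • pdRing hU c a := by
  obtain ⟨T, g, hg⟩ := a.2
  ext p
  refine (Represents.pdRing_apply hU (a := r • a) ((Represents.const T r).mul hg) c p).trans ?_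
  rw [fderiv_const_mul (hg.differentiableAt hU p)]
  exact (((Represents.const T r).mul (hg.pdRing hU c)).2 p).symm

theorem pdRing_comm (b c : Coord n m h) (a : smoothAlgebra U) :
    pdRing hU b (pdRing hU c a) = pdRing hU c (pdRing hU b a) := by
  obtain ⟨T, g, hg⟩ := a.2
  ext p
  have hsmooth := hg.contDiffAt hU p
  have hd : DifferentiableAt ℝ (fderiv ℝ g) (proj T p) :=
    (hsmooth.fderiv_right (m := 1) (by norm_cast)).differentiableAt (by simp)
  have hsecond (v w : T → ℝ) : fderiv ℝ (fun y => fderiv ℝ g y v) (proj T p) w =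
      fderiv ℝ (fderiv ℝ g) (proj T p) w v := by
    simp [fderiv_clm_apply hd (differentiableAt_const v)]
  rw [(hg.pdRing hU c).pdRing_apply, (hg.pdRing hU b).pdRing_apply, hsecond, hsecond]
  exact (hsmooth.isSymmSndFDerivAt (by simp; norm_cast)).eq _ _

theorem Represents.pdRing_eq_zero {T : Finset (Coord n m h)} {g : (T → ℝ) → ℝ}
    {a : smoothAlgebra U} (ha : Represents U T g a) {c : Coord n m h} (hc : c ∉ T) :
    GenEvol.pdRing hU c a = 0 := by
  ext p
  rw [ha.pdRing_apply, dir_eq_zero hc, map_zero]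
  rfl

/-- The coordinate functions on `U`. -/
def coordRing (U : Set (Jet n m h)) (c : Coord n m h) : smoothAlgebra U :=
  ⟨fun p => (p : Jet n m h) c, {c}, _, Represents.coord (Finset.mem_singleton_self c)⟩

theorem rep_coordRing (c : Coord n m h) : Rep (fun p => p c) (coordRing U c) :=
  fun _ => rfl

/-- The partial derivatives on the ring of smooth functions on an open set `U`. -/
def jetPartials : Partials (Coord n m h) (smoothAlgebra U) where
  d c := Derivation.mk'
    { toFun := pdRing hU c
      map_add' := pdRing_add hU c
      map_smul' := pdRing_smul hU c }
    (pdRing_mul hU c)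
  coord := coordRing U
  comm := pdRing_comm hU
  finite a := by
    obtain ⟨T, g, hg⟩ := a.2
    exact T.finite_toSet.subset fun c hc => by_contra fun hcT => hc (hg.pdRing_eq_zero hU hcT)
  d_coord_self c := by
    classical
    ext p
    refine ((rep_coordRing c).pdRing hU c p).symm.trans ?_
    simp [pd]
  d_coord_of_ne {c c'} hc := by
    classical
    ext p
    refine ((rep_coordRing c').pdRing hU c p).symm.trans ?_
    simp [pd, Function.update_of_ne hc.symm]

theorem Rep.d {f : JetFun n m h} {a : smoothAlgebra U} (hf : Rep f a) (c : Coord n m h) :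
    Rep (pd c f) ((jetPartials hU).d c a) :=
  hf.pdRing hU c

end SmoothAlgebra

theorem sum_Ico_one_eq_sum_fin {M : Type*} [AddCommMonoid M] (h : ℕ) (φ : ℕ → M) :
    ∑ s ∈ Finset.Ico 1 h, φ s = ∑ s : Fin h, if (s : ℕ) = 0 then 0 else φ s := by
  rw [Fin.sum_univ_eq_sum_range (fun s => if s = 0 then 0 else φ s), Finset.sum_ite,
    Finset.sum_const_zero, zero_add]
  refine Finset.sum_congr (Finset.ext fun s => ?_) fun _ _ => rfl
  simp only [Finset.mem_Ico, Finset.mem_filter, Finset.mem_range]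
  lia

section Rep

variable {n m h : ℕ} {U : Set (Jet n m h)} {f f' : JetFun n m h} {a a' : smoothAlgebra U}

/-- Evaluation at a point of `U`. -/
def evalAt (p : U) : smoothAlgebra U →ₐ[ℝ] ℝ :=
  (Pi.evalAlgHom ℝ (fun _ : U => ℝ) p).comp (smoothAlgebra U).val

theorem rep_zero : Rep (fun _ => 0) (0 : smoothAlgebra U) := fun _ => rfl

theorem Rep.add (hf : Rep f a) (hf' : Rep f' a') : Rep (fun p => f p + f' p) (a + a') :=
  fun p => congrArg₂ (· + ·) (hf p) (hf' p)

theorem Rep.const_mul (r : ℝ) (hf : Rep f a) : Rep (fun p => r * f p) (r • a) :=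
  fun p => congrArg (r * ·) (hf p)

theorem Rep.sum {ι : Type*} {φ : ι → JetFun n m h} {α : ι → smoothAlgebra U} (T : Finset ι)
    (hφ : ∀ i, Rep (φ i) (α i)) : Rep (fun p => ∑ i ∈ T, φ i p) (∑ i ∈ T, α i) :=
  fun p => (Finset.sum_congr rfl fun i _ => hφ i p).trans (map_sum (evalAt p) α T).symm

theorem Rep.finsum {ι : Type*} {φ : ι → JetFun n m h} {α : ι → smoothAlgebra U}
    (hφ : ∀ i, Rep (φ i) (α i)) (hα : (Function.support α).Finite) :
    Rep (fun p => ∑ᶠ i, φ i p) (∑ᶠ i, α i) :=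
  fun p => (finsum_congr fun i => hφ i p).trans
    ((evalAt p : smoothAlgebra U →+ ℝ).map_finsum hα).symm

theorem Rep.iterate {D : JetFun n m h → JetFun n m h} {E : Module.End ℝ (smoothAlgebra U)}
    (hD : ∀ {f a}, Rep f a → Rep (D f) (E a)) (hf : Rep f a) (r : ℕ) :
    Rep (D^[r] f) ((E ^ r) a) := by
  induction r with
  | zero => exact hf
  | succ r ih =>
    rw [Function.iterate_succ_apply', pow_succ', Module.End.mul_apply]
    exact hD ih

variable (hU : IsOpen U)

theorem vf_eval (b : Coord n m h → smoothAlgebra U) (a : smoothAlgebra U) (p : U) :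
    evalAt p ((jetPartials hU).vf b a) =
      evalAt p (b .t) * evalAt p ((jetPartials hU).d .t a) +
      ∑ j, evalAt p (b (.x j)) * evalAt p ((jetPartials hU).d (.x j) a) +
      ∑ᶠ c : Fin h × Fin m × (Fin n →₀ ℕ), evalAt p (b (.u c.1 c.2.1 c.2.2)) *
        evalAt p ((jetPartials hU).d (.u c.1 c.2.1 c.2.2) a) := by
  have hfin : (Function.support fun c => b c * (jetPartials hU).d c a).Finite :=
    ((jetPartials hU).finite a).subset fun c hc h => hc (by simp only [h, mul_zero])
  rw [Partials.vf_eq_finsum, Coord.finsum_eq _ hfin, map_add, map_add, map_sum]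
  simp only [← map_mul]
  congr 1
  exact (evalAt p : smoothAlgebra U →+ ℝ).map_finsum (hfin.preimage Coord.u_injective.injOn)

theorem Rep.dx (hf : Rep f a) (j : Fin n) : Rep (Dx j f) ((jetPartials hU).dx j a) := fun p => by
  refine Eq.trans ?_ (vf_eval hU _ a p).symm
  simp only [Partials.dxCoeff, map_zero, zero_mul, zero_add, apply_ite (evalAt p), map_one,
    ite_mul, one_mul, Finset.sum_ite_eq', Finset.mem_univ, if_true]
  exact congrArg₂ (· + ·) (hf.d hU _ p)
    (finsum_congr fun c => congrArg₂ (· * ·) rfl (hf.d hU _ p))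

theorem Rep.dxI (hf : Rep f a) (I : Fin n →₀ ℕ) : Rep (DxI I f) ((jetPartials hU).dxI I a) := by
  rw [DxI, Partials.dxI, DiffOp.iter, multiPow]
  induction List.finRange n with
  | nil => exact hf
  | cons j l ih =>
    rw [List.foldr_cons, List.map_cons, List.prod_cons, Module.End.mul_apply]
    exact ih.iterate (fun hf => hf.dx hU j) _

theorem Rep.characteristic [NeZero h] (hf : Rep f a) (i : Fin m) :
    Rep (characteristic f i) ((jetPartials hU).varDeriv (h - 1) i a) := by
  rw [Partials.varDeriv_apply, DiffOp.adjointEnd_apply]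
  refine Rep.finsum (fun I => ?_) ?_
  · rw [mul_one, Partials.coeff_lin]
    exact ((hf.d hU _).dxI hU I).const_mul _
  · refine (MvPolynomial.support ((jetPartials hU).lin (h - 1) i a)).finite_toSet.subset
      fun I hI => MvPolynomial.mem_support_iff.2 fun h0 => hI ?_
    simp only [h0, zero_mul, map_zero, smul_zero]

variable {F : Fin m → JetFun n m h} {α : Fin m → smoothAlgebra U} (hF : ∀ i, Rep (F i) (α i))

include hF

theorem Rep.dt (hf : Rep f a) : Rep (Dt F f) ((jetPartials hU).dt α a) := fun p => by
  refine Eq.trans ?_ (vf_eval hU _ a p).symm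
  simp only [Partials.dtCoeff, map_one, one_mul, map_zero, zero_mul, Finset.sum_const_zero,
    add_zero]
  refine congrArg₂ (· + ·) (hf.d hU _ p) (finsum_congr fun c => ?_)
  refine congrArg₂ (· * ·) ?_ (hf.d hU _ p)
  split_ifs
  · rfl
  · exact (hF _).dxI hU _ p

theorem Rep.iterate_dt_pd (s : Fin h) (r : ℕ) (i k : Fin m) :
    Rep ((Dt F)^[r] (pd (.u s i 0) (F k)))
      (((jetPartials hU).dt α ^ r : Module.End ℝ (smoothAlgebra U))
        (((jetPartials hU).lin s i (α k)).coeff 0)) := by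
  rw [Partials.coeff_lin _ s.2]
  exact ((hF k).d hU _).iterate (fun hf => hf.dt hU hF) r

theorem Rep.coeffT (i k : Fin m) {r : Fin h} (hr : (r : ℕ) ≠ 0) :
    Rep (coeffT F i k r) ((jetPartials hU).timeCoeff α i k r) := by
  rw [Partials.timeCoeff, sum_Ico_one_eq_sum_fin]
  refine Rep.sum _ fun s => ?_
  by_cases hs : r ≤ s
  · have hs0 : (s : ℕ) ≠ 0 := fun h0 => hr (Nat.le_zero.1 (h0 ▸ hs))
    simp only [hs, hs0, if_true, if_false]
    exact (Rep.iterate_dt_pd hU hF s _ i k).const_mul _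
  · simp only [hs, if_false, Nat.choose_eq_zero_of_lt (not_le.1 hs), Nat.cast_zero, mul_zero,
      zero_smul, ite_self]
    exact rep_zero

theorem Rep.coeffX [NeZero h] (i k : Fin m) (K : Fin n →₀ ℕ) :
    Rep (coeffX F i k K) (((jetPartials hU).spaceOp α i k).coeff K) := by
  rw [Partials.spaceOp, MvPolynomial.coeff_add, MvPolynomial.coeff_C,
    DiffOp.coeff_adjoint (jetPartials hU).dx_comm]
  refine Rep.add (Rep.finsum (fun I => ?_) ?_) ?_
  · rw [← Nat.cast_smul_eq_nsmul ℝ, smul_smul, Nat.cast_prod, Partials.coeff_lin _ (NeZero.pos h)]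
    exact (((hF k).d hU _).dxI hU I).const_mul _
  · refine ((MvPolynomial.support ((jetPartials hU).lin 0 i (α k))).finite_toSet.preimage
      (add_right_injective K).injOn).subset fun I hI => MvPolynomial.mem_support_iff.2 fun h0 =>
        hI ?_
    simp only [h0, map_zero, smul_zero]
  · simp only [eq_comm (a := (0 : Fin n →₀ ℕ))]
    split_ifs
    · rw [Partials.timeCoeff, sum_Ico_one_eq_sum_fin]
      refine Rep.sum _ fun s => ?_
      simp only [Fin.val_eq_zero_iff, Nat.choose_zero_right, Nat.cast_one, mul_one, Nat.sub_zero]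
      split_ifs
      · exact rep_zero
      · exact (Rep.iterate_dt_pd hU hF s _ i k).const_mul _
    · exact rep_zero

end Rep

open MvPolynomial Matrix

section Order

variable {n m h : ℕ} {U : Set (Jet n m h)} (hU : IsOpen U)

theorem Rep.exists_pd_ne_zero_iff {f : JetFun n m h} {a : smoothAlgebra U} (hf : Rep f a)
    (c : Coord n m h) : (∃ p ∈ U, pd c f p ≠ 0) ↔ (jetPartials hU).d c a ≠ 0 := by
  rw [← not_iff_not, not_not]
  push Not
  refine ⟨fun h0 => Subtype.ext (funext fun p => ?_), fun h0 p hp => ?_⟩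
  · exact (hf.d hU c p).symm.trans (h0 p p.2)
  · exact (hf.d hU c ⟨p, hp⟩).trans (by rw [h0]; rfl)

variable {ι : Type*} {f : ι → JetFun n m h} {α : ι → smoothAlgebra U} (hf : ∀ i, Rep (f i) (α i))

include hU hf

theorem order_eq_neg_one (h0 : ∀ i, α i = 0) : order U f = -1 := by
  rw [order, (Set.eq_empty_iff_forall_notMem (s := {d : ℤ | _})).2, insert_empty_eq,
    csSup_singleton]
  rintro d ⟨s, i, I, -, a, hp⟩
  exact ((hf a).exists_pd_ne_zero_iff hU _).1 hp (by rw [h0, map_zero])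

theorem bddAbove_order [Finite ι] :
    BddAbove (insert (-1) {d : ℤ | ∃ s i I, d = ((I : Fin n →₀ ℕ).degree : ℤ) ∧
      ∃ a, ∃ p ∈ U, pd (.u s i I) (f a) p ≠ 0}) := by
  refine (((Set.finite_iUnion fun a => (jetPartials hU).finite (α a)).preimage
    Coord.u_injective.injOn).image
      (fun c : Fin h × Fin m × (Fin n →₀ ℕ) => (c.2.2.degree : ℤ))).subset ?_
    |>.insert _ |>.bddAbove
  rintro d ⟨s, i, I, rfl, a, hp⟩
  exact ⟨(s, i, I), Set.mem_iUnion.2 ⟨a, ((hf a).exists_pd_ne_zero_iff hU _).1 hp⟩, rfl⟩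

theorem degree_le_order [Finite ι] {s : Fin h} {i : Fin m} {I : Fin n →₀ ℕ} {a : ι}
    (h0 : (jetPartials hU).d (.u s i I) (α a) ≠ 0) : (I.degree : ℤ) ≤ order U f := by
  refine le_csSup (bddAbove_order hU hf) (Or.inr ?_)
  exact ⟨s, i, I, rfl, a, ((hf a).exists_pd_ne_zero_iff hU _).2 h0⟩

theorem totalDegree_lin_le [Finite ι] {b : ℕ} (hb : order U f ≤ b) (s : ℕ) (i : Fin m) (a : ι) :
    ((jetPartials hU).lin s i (α a)).totalDegree ≤ b := by
  by_cases hs : s < h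
  · refine Finset.sup_le fun I hI => ?_
    rw [mem_support_iff, Partials.coeff_lin _ hs] at hI
    exact_mod_cast (degree_le_order hU hf hI).trans hb
  · rw [Partials.lin_of_le _ (not_lt.1 hs), totalDegree_zero]
    exact b.zero_le

theorem homogeneousComponent_lin_eq_zero [NeZero h] {b : ℕ} (hb : order U f = b) {s : ℕ}
    (hs : timeOrder U f < s) (i : Fin m) (a : ι) :
    homogeneousComponent b ((jetPartials hU).lin s i (α a)) = 0 := by
  classical
  by_cases hsh : s < h
  · refine homogeneousComponent_eq_zero' _ _ fun I hI hIb => hs.not_ge ?_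
    rw [mem_support_iff, Partials.coeff_lin _ hsh] at hI
    have hle : (⟨s, hsh⟩ : Fin h) ≤ timeOrder U f := by
      refine Finset.le_sup (f := id) (Finset.mem_filter.2 ⟨Finset.mem_univ _, i, I, ?_, a, ?_⟩)
      · rw [hIb, hb]
      · exact ((hf a).exists_pd_ne_zero_iff hU _).2 hI
    exact hle
  · rw [Partials.lin_of_le _ (not_lt.1 hsh), map_zero]

end Order

section OrderBound

variable {n m h : ℕ} {U : Set (Jet n m h)} (hU : IsOpen U)

theorem totalDegree_lin_eq_zero {f : JetFun n m h} (hf : IsSmoothIn (admissible n m h) U f)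
    {a : smoothAlgebra U} (ha : Rep f a) {s : ℕ} (hs : s ≠ 0) (i : Fin m) :
    ((jetPartials hU).lin s i a).totalDegree = 0 := by
  by_cases hsh : s < h
  · obtain ⟨T, hT, g, hg⟩ := hf.exists_represents
    refine Nat.le_zero.1 (Finset.sup_le fun I hI => ?_)
    rw [mem_support_iff, Partials.coeff_lin _ hsh] at hI
    have hmem : Coord.u ⟨s, hsh⟩ i I ∈ T := by
      refine by_contra fun hc => hI (Represents.pdRing_eq_zero hU (g := g) ?_ hc)
      rwa [← (funext ha : (fun p : U => f p) = a)]
    rw [(hT hmem _ _ _ rfl).resolve_left hs]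
    rfl
  · rw [Partials.lin_of_le _ (not_lt.1 hsh), totalDegree_zero]

variable [NeZero h] {F : Fin m → JetFun n m h} {α : Fin m → smoothAlgebra U}
  (hα : ∀ i, Rep (F i) (α i))

include hU hα

theorem bddAbove_orderBound : BddAbove (insert (-1)
    ({d : ℤ | ∃ i j K, d = order U (fun _ : Unit => coeffX F i j K) - order U F} ∪
      {d : ℤ | ∃ i j r, r ≠ 0 ∧ d = order U (fun _ : Unit => coeffT F i j r) - order U F})) := by
  refine ((Set.Finite.union ?_ ?_).insert _).bddAbove
  · refine ((Set.finite_iUnion fun c : Fin m × Fin m =>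
      ((jetPartials hU).spaceOp α c.1 c.2).support.finite_toSet.image fun K =>
        order U (fun _ : Unit => coeffX F c.1 c.2 K) - order U F).union
          (Set.finite_singleton (-1 - order U F))).subset ?_
    rintro d ⟨i, j, K, rfl⟩
    by_cases hK : K ∈ ((jetPartials hU).spaceOp α i j).support
    · exact Or.inl (Set.mem_iUnion.2 ⟨(i, j), K, hK, rfl⟩)
    · refine Or.inr (congrArg (· - _) ?_)
      exact order_eq_neg_one hU (fun _ => Rep.coeffX hU hα i j K) fun _ => notMem_support_iff.1 hK
  · refine (Set.finite_range fun c : Fin m × Fin m × Fin h =>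
      order U (fun _ : Unit => coeffT F c.1 c.2.1 c.2.2) - order U F).subset ?_
    rintro d ⟨i, j, r, -, rfl⟩
    exact ⟨(i, j, r), rfl⟩

theorem neg_one_le_orderBound : -1 ≤ orderBound U F :=
  le_csSup (bddAbove_orderBound hU hα) (Set.mem_insert _ _)

theorem order_coeffX_le (i j : Fin m) (K : Fin n →₀ ℕ) :
    order U (fun _ : Unit => coeffX F i j K) ≤ orderBound U F + order U F :=
  sub_le_iff_le_add.1 <| le_csSup (bddAbove_orderBound hU hα)
    (Set.mem_insert_of_mem _ (Or.inl ⟨i, j, K, rfl⟩))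

theorem order_coeffT_le (i j : Fin m) {r : Fin h} (hr : r ≠ 0) :
    order U (fun _ : Unit => coeffT F i j r) ≤ orderBound U F + order U F :=
  sub_le_iff_le_add.1 <| le_csSup (bddAbove_orderBound hU hα)
    (Set.mem_insert_of_mem _ (Or.inr ⟨i, j, r, hr, rfl⟩))

theorem totalDegree_lin_coeff_spaceOp_le {b : ℕ} (hb : orderBound U F + order U F ≤ b)
    (i k : Fin m) (K : Fin n →₀ ℕ) (s : ℕ) (j : Fin m) :
    ((jetPartials hU).lin s j (((jetPartials hU).spaceOp α i k).coeff K)).totalDegree ≤ b :=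
  totalDegree_lin_le hU (fun _ : Unit => Rep.coeffX hU hα i k K)
    ((order_coeffX_le hU hα i k K).trans hb) s j ()

theorem totalDegree_lin_timeCoeff_le {b : ℕ} (hb : orderBound U F + order U F ≤ b)
    (i k : Fin m) {r : ℕ} (hr : r ∈ Finset.Ico 1 h) (s : ℕ) (j : Fin m) :
    ((jetPartials hU).lin s j ((jetPartials hU).timeCoeff α i k r)).totalDegree ≤ b := by
  obtain ⟨hr1, hrh⟩ := Finset.mem_Ico.1 hr
  have hr0 : r ≠ 0 := Nat.one_le_iff_ne_zero.1 hr1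
  exact totalDegree_lin_le hU (fun _ : Unit => Rep.coeffT hU hα i k (r := ⟨r, hrh⟩) hr0)
    ((order_coeffT_le hU hα i k (Fin.val_ne_zero_iff.1 hr0)).trans hb) s j ()

omit hα in
theorem timeOrder_eq_zero (hF : ∀ i, IsSmoothIn (admissible n m h) U (F i))
    (hN : 0 < order U F) : timeOrder U F = 0 := by
  classical
  refine le_antisymm (Finset.sup_le fun s hs => not_lt.1 fun hs0 => ?_) (Fin.zero_le _)
  obtain ⟨i, I, hI, k, hp⟩ := (Finset.mem_filter.1 hs).2
  obtain ⟨a, ha⟩ := (hF k).exists_rep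
  rw [ha.exists_pd_ne_zero_iff hU, ← Partials.coeff_lin _ s.2, ← mem_support_iff] at hp
  have hdeg : I.degree ≤ 0 := (le_totalDegree hp).trans
    (totalDegree_lin_eq_zero hU (hF k) ha (Fin.val_ne_of_ne hs0.ne') i).le
  omega

end OrderBound

section Symbol

variable {n m h : ℕ} {U : Set (Jet n m h)}

theorem symbolAt_eq_map {ι : Type*} (hU : IsOpen U) {f : ι → JetFun n m h}
    {α : ι → smoothAlgebra U} (hf : ∀ i, Rep (f i) (α i)) (a : ℕ) (b : Fin h) :
    symbolAt U a b f =
      ((jetPartials hU).symbolAt a b α).map (MvPolynomial.map (algebraMap _ (U → ℝ))) := by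
  classical
  refine Matrix.ext fun i j => MvPolynomial.ext _ _ fun K => ?_
  have hmem : K ∈ (Finset.univ : Finset (Fin n)).finsuppAntidiag a ↔ K.degree = a := by
    rw [Finset.mem_finsuppAntidiag, Finsupp.degree_eq_sum]
    exact and_iff_left (Finset.subset_univ _)
  rw [symbolAt, coeff_sum, Matrix.map_apply, coeff_map, Partials.symbolAt, Matrix.of_apply,
    coeff_homogeneousComponent, Partials.coeff_lin _ b.2, apply_ite (algebraMap _ _), map_zero]
  simp only [coeff_monomial, Finset.sum_ite_eq', hmem]
  split_ifs
  · exact funext ((hf i).d hU _)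
  · rfl

theorem isSkewAdjoint_map {ι R R' : Type*} [Fintype ι] [CommRing R] [CommRing R']
    {S A : Matrix ι ι R} (h : S.IsSkewAdjoint A) (ψ : R →+* R') :
    (S.map ψ).IsSkewAdjoint (A.map ψ) := by
  have hmap := congrArg (fun M : Matrix ι ι R => M.map ψ) h
  simp only [Matrix.map_mul, Matrix.map_neg _ (map_neg ψ)] at hmap
  exact hmap

theorem isSkewAdjoint_of_map {ι R R' : Type*} [Fintype ι] [CommRing R] [CommRing R']
    {S A : Matrix ι ι R} {ψ : R →+* R'} (hψ : Function.Injective ψ)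
    (h : (S.map ψ).IsSkewAdjoint (A.map ψ)) : S.IsSkewAdjoint A := by
  refine Matrix.map_injective hψ ?_
  simp only [Matrix.map_mul, Matrix.map_neg _ (map_neg ψ)]
  exact h

variable [NeZero h] {F : Fin m → JetFun n m h} {J₀ : JetFun n m h} {J : Fin n → JetFun n m h}
  (hU : IsOpen U)

omit [NeZero h] in
theorem varDeriv_dt_eq_zero (hJ : IsConservedCurrent U F J₀ J) {α : Fin m → smoothAlgebra U}
    (hα : ∀ i, Rep (F i) (α i)) {a₀ : smoothAlgebra U} (ha₀ : Rep J₀ a₀) (s : ℕ) (i : Fin m) :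
    (jetPartials hU).varDeriv s i ((jetPartials hU).dt α a₀) = 0 := by
  choose a ha using fun j => (hJ.2.1 j).exists_rep
  have hdiv : (jetPartials hU).dt α a₀ + ∑ j, (jetPartials hU).dx j (a j) = 0 :=
    Subtype.ext (funext fun p => ((ha₀.dt hU hα).add
      (Rep.sum Finset.univ fun j => (ha j).dx hU j) p).symm.trans (hJ.2.2 p p.2))
  rw [eq_neg_of_add_eq_zero_left hdiv, map_neg, map_sum, neg_eq_zero]
  exact Finset.sum_eq_zero fun j _ => Partials.varDeriv_dx _ s i j _

variable (hF : ∀ i, IsSmoothIn (admissible n m h) U (F i)) (hN : 0 < order U F)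
  (hodd : Odd (order U F + h)) (hJ : IsConservedCurrent U F J₀ J)
  (hord : orderBound U F < order U (characteristic J₀))

include hU hF hN hodd hJ hord

theorem isSkewAdjoint_symbolAt {α : Fin m → smoothAlgebra U} (hα : ∀ i, Rep (F i) (α i))
    {a₀ : smoothAlgebra U} (ha₀ : Rep J₀ a₀) :
    ((jetPartials hU).symbolAt (order U (characteristic J₀)).toNat
      (timeOrder U (characteristic J₀))
      fun i => (jetPartials hU).varDeriv (h - 1) i a₀).IsSkewAdjoint
        ((jetPartials hU).symbolAt (order U F).toNat 0 α) := by
  have hχ := fun i => ha₀.characteristic hU i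
  have hneg := neg_one_le_orderBound hU hα
  obtain ⟨N, hFN⟩ := Int.eq_ofNat_of_zero_le hN.le
  obtain ⟨M, hχM⟩ : ∃ M : ℕ, order U (characteristic J₀) = M := Int.eq_ofNat_of_zero_le (by omega)
  have hbound : orderBound U F + order U F ≤ (M + N - 1 : ℕ) := by omega
  rw [hFN] at hodd
  have hsign : (-1 : ℝ) ^ h = -(-1) ^ N := by
    have hparity : Odd (N + h) := mod_cast hodd
    rw [← mul_neg_one ((-1) ^ N), ← pow_succ]
    exact neg_one_pow_congr (by
      rw [Nat.even_add_one, Nat.not_even_iff_odd, Nat.odd_add.1 hparity])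
  have hkey := (jetPartials hU).neg_one_pow_smul_symbolAt_mul (timeOrder U (characteristic J₀)).2
    (by omega) (fun i => totalDegree_lin_le hU hα hFN.le 0 i)
    (fun s i k hs => totalDegree_lin_eq_zero hU (hF k) (hα k) hs i)
    (varDeriv_dt_eq_zero hU hJ hα ha₀)
    (fun i => .of_top_eq_zero (by omega) (fun s j => totalDegree_lin_le hU hχ hχM.le s j i)
      fun s j hs => homogeneousComponent_lin_eq_zero hU hχ hχM hs j i)
    (fun i k K s j => (totalDegree_lin_coeff_spaceOp_le hU hα hbound i k K s j).trans_lt (by omega))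
    (fun i k r hr s j => (totalDegree_lin_timeCoeff_le hU hα hbound i k hr s j).trans_lt (by omega))
  rw [hsign, neg_smul, ← smul_neg] at hkey
  have hcancel := smul_right_injective _ (pow_ne_zero N (neg_ne_zero.2 (one_ne_zero (α := ℝ)))) hkey
  rw [hFN, hχM]
  exact hcancel.symm.trans (mul_neg _ _).symm

theorem isSkewAdjoint_symbol :
    (symbol U (characteristic J₀)).IsSkewAdjoint (symbol U F) := by
  choose α hα using fun i => (hF i).exists_rep
  obtain ⟨a₀, ha₀⟩ := hJ.1.exists_rep
  rw [symbol, symbol, timeOrder_eq_zero hU hF hN, symbolAt_eq_map hU hα,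
    symbolAt_eq_map hU fun i => ha₀.characteristic hU i]
  exact isSkewAdjoint_map (isSkewAdjoint_symbolAt hU hF hN hodd hJ hord hα ha₀) _

end Symbol

end GenEvol

end

theorem theorem5 (n m h : ℕ) [NeZero h] (U : Set (Jet n m h)) (hU : IsOpen U)
    (F : Fin m → JetFun n m h) (hF : ∀ i, IsSmoothIn (admissible n m h) U (F i))
    (hN : 0 < order U F) (hodd : Odd (order U F + h))
    (J₀ : JetFun n m h) (J : Fin n → JetFun n m h) (hJ : IsConservedCurrent U F J₀ J)
    (hord : orderBound U F < order U (characteristic J₀))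
    (B : Subalgebra ℝ (U → ℝ)) (A S : Matrix (Fin m) (Fin m) (MvPolynomial (Fin n) B))
    (hA : A.map (MvPolynomial.map (algebraMap B (U → ℝ))) = symbol U F)
    (hS : S.map (MvPolynomial.map (algebraMap B (U → ℝ))) = symbol U (characteristic J₀))
    {k : Type*} [Field k] (φ : B →+* k) (hns : (specialize φ S).det ≠ 0) :
    (∀ d : Fin m → Polynomial (FractionRing (MvPolynomial (Fin n) k)),
      IsInvariantFactors (specialize φ A) d → ∀ i, IsSkew (d i)) ∧
    IsSkew (specialize φ A).charpoly ∧
    (specialize φ A).trace = 0 ∧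
    (Odd m → (specialize φ A).det = 0) := by
  have hinj : Function.Injective (MvPolynomial.map (σ := Fin n) (algebraMap B (U → ℝ))) :=
    MvPolynomial.map_injective _ Subtype.val_injective
  have hSA : S.IsSkewAdjoint A := isSkewAdjoint_of_map hinj <| by
    rw [hS, hA]
    exact isSkewAdjoint_symbol hU hF hN hodd hJ hord
  let ι := algebraMap (MvPolynomial (Fin n) k) (FractionRing (MvPolynomial (Fin n) k))
  have hspec : (specialize φ S).IsSkewAdjoint (specialize φ A) :=
    isSkewAdjoint_map hSA (ι.comp (MvPolynomial.map φ))
  have : CharZero (FractionRing (MvPolynomial (Fin n) k)) := charZero_of_injective_ringHom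
    (ι.comp (MvPolynomial.C.comp (φ.comp (algebraMap ℝ B)))).injective
  exact ⟨fun d hd => isSkew_of_isInvariantFactors hns hspec hd, isSkew_charpoly hns hspec,
    trace_eq_zero hns hspec, fun hm => det_eq_zero hns hspec (by rwa [Fintype.card_fin])⟩
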